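/- **Setting.** Let $f:\mathbb{R}\to(0,\infty)$ be a merit function (no lower bound, continuity or Lipschitz condition is imposed) and $\theta^\star\in\mathbb{R}^d$. In each round $t=1,2,\dots$ contexts $x_{t,1},\dots,x_{t,K}\in\mathbb{R}^d$ are revealed (they may depend on the past), the learner deploys a policy $\pi_t$ on $\{1,\dots,K\}$, an arm $a_t$ is sampled from $\pi_t$ given the history, the current contexts and $\pi_t$, and a reward $r_t$ is observed whose conditional mean, given the history, the current contexts, $\pi_t$ and $a_t$, is $\theta^\star\cdot x_{t,a_t}$; put $\eta_t=r_t-\theta^\star\cdot x_{t,a_t}$. The optimal fair policy of round $t$ is $\pi^\star_t(a)=f(\theta^\star\cdot x_{t,a})/\sum_{a'}f(\theta^\star\cdot x_{t,a'})$, and the reward regret is $$\mathrm{RR}_T=\sum_{t=1}^T\sum_a\pi^\star_t(a)\,\theta^\star\cdot x_{t,a}-\sum_{t=1}^T\sum_a\pi_t(a)\,\theta^\star\cdot x_{t,a}.$$ **Algorithm (FairX-LinUCB with parameters $\lambda$ and $(\beta_t)$).** Let $V_t=\lambda I_d+\sum_{s<t}x_{s,a_s}x_{s,a_s}^\top$,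 $b_t=\sum_{s<t}r_s x_{s,a_s}$, $\hat\theta_t=V_t^{-1}b_t$ and $C_t=\{\theta:\ (\theta-\hat\theta_t)^\top V_t(\theta-\hat\theta_t)\le\beta_t\}$. In round $t$ the algorithm picks any $$\theta_t\in\arg\max_{\theta\in C_t}\sum_a\frac{f(\theta\cdot x_{t,a})}{\sum_{a'}f(\theta\cdot x_{t,a'})}\,\theta\cdot x_{t,a}$$ (the maximum is assumed to be attained) and deploys $\pi_t(a)=f(\theta_t\cdot x_{t,a})/\sum_{a'}f(\theta_t\cdot x_{t,a'})$. **Theorem.** There are universal constants $C>0$ and $k\in\mathbb{N}$ such that the following holds for all $d$, $K$, $f$ and all $\delta\in(0,1)$. Suppose that $\|x_{t,a}\|_2\le1$ for all $t,a$, that $\|\theta^\star\|_2\le1$, and that $\eta_t$ is conditionally $1$-sub-Gaussian, i.e. $\mathbb{E}[e^{s\eta_t}\mid\text{history},(x_{t,a})_a,\pi_t,a_t]\le e^{s^2/2}$ for all $s\in\mathbb{R}$ and all $t$. Run FairX-LinUCB with $\lambda=1$ and $$\beta_t=\Bigl(1+\sqrt{d\ln(1+t/d)+2\ln\bigl(\pi^2t^2/(3\delta)\bigr)}\Bigr)^2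 .$$ Then for every $T\ge1$, with probability at least $1-\delta$, $$\mathrm{RR}_T\le C\,d\,\sqrt{T}\,\bigl(1+\ln(T/\delta)\bigr)^k .$$ -/

import Mathlib

open MeasureTheory

namespace FairX

noncomputable section

/-! Rounds are numbered `1, 2, 3, …`; the value of a process at index `0` is never used.
`x t ω a` is the context of arm `a` in round `t`, `pol t ω a` the probability that the deployed
policy gives to arm `a`, `A t ω` the sampled arm and `R t ω` the observed reward. -/

section Policies

variable {d K : ℕ}

/-- The policy over the arms with contexts `x` that is proportional to merit, computed as if
`θ` were the true parameter. For the true parameter this is the optimal fair policy. -/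
def fairPolicy (f : ℝ → ℝ) (θ : EuclideanSpace ℝ (Fin d))
    (x : Fin K → EuclideanSpace ℝ (Fin d)) (a : Fin K) : ℝ :=
  f (inner ℝ θ (x a)) / ∑ b, f (inner ℝ θ (x b))

/-- Expected reward of a policy `p` over arms with contexts `x` when the parameter is `θ`. -/
def expectedReward (θ : EuclideanSpace ℝ (Fin d))
    (x : Fin K → EuclideanSpace ℝ (Fin d)) (p : Fin K → ℝ) : ℝ :=
  ∑ a, p a * inner ℝ θ (x a)

end Policies

section Processes

variable {Ω : Type*} {d K : ℕ}

/-- Cumulative reward regret after `T` rounds against the per-round optimal fair policies. -/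
def rewardRegret (f : ℝ → ℝ) (θstar : EuclideanSpace ℝ (Fin d))
    (x : ℕ → Ω → Fin K → EuclideanSpace ℝ (Fin d)) (pol : ℕ → Ω → Fin K → ℝ)
    (T : ℕ) (ω : Ω) : ℝ :=
  ∑ t ∈ Finset.Icc 1 T, expectedReward θstar (x t ω) (fairPolicy f θstar (x t ω)) -
    ∑ t ∈ Finset.Icc 1 T, expectedReward θstar (x t ω) (pol t ω)

/-- The σ-algebra of the history before round `t`: contexts, policies, sampled arms and observed
rewards of the rounds `1, …, t - 1`. -/
abbrev history (x : ℕ → Ω → Fin K → EuclideanSpace ℝ (Fin d)) (pol : ℕ → Ω → Fin K → ℝ)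
    (A : ℕ → Ω → Fin K) (R : ℕ → Ω → ℝ) (t : ℕ) : MeasurableSpace Ω :=
  ⨆ s ∈ Finset.Ico 1 t,
    (MeasurableSpace.comap (x s) inferInstance ⊔ MeasurableSpace.comap (pol s) inferInstance ⊔
      MeasurableSpace.comap (A s) inferInstance ⊔ MeasurableSpace.comap (R s) inferInstance)

/-- What is known in round `t` just before the arm is sampled: the history, the contexts of
round `t` and the policy of round `t`. -/
abbrev policyInfo (x : ℕ → Ω → Fin K → EuclideanSpace ℝ (Fin d)) (pol : ℕ → Ω → Fin K → ℝ)
    (A : ℕ → Ω → Fin K) (R : ℕ → Ω → ℝ) (t : ℕ) : MeasurableSpace Ω :=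
  history x pol A R t ⊔ MeasurableSpace.comap (x t) inferInstance ⊔
    MeasurableSpace.comap (pol t) inferInstance

/-- What is known in round `t` just after the arm is sampled, before the reward is revealed. -/
abbrev armInfo (x : ℕ → Ω → Fin K → EuclideanSpace ℝ (Fin d)) (pol : ℕ → Ω → Fin K → ℝ)
    (A : ℕ → Ω → Fin K) (R : ℕ → Ω → ℝ) (t : ℕ) : MeasurableSpace Ω :=
  policyInfo x pol A R t ⊔ MeasurableSpace.comap (A t) inferInstance

/-- The noise `η_t` of the reward observed in round `t`. -/
def noise (θstar : EuclideanSpace ℝ (Fin d)) (x : ℕ → Ω → Fin K → EuclideanSpace ℝ (Fin d))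
    (A : ℕ → Ω → Fin K) (R : ℕ → Ω → ℝ) (t : ℕ) (ω : Ω) : ℝ :=
  R t ω - inner ℝ θstar (x t ω (A t ω))

/-- Interaction of a policy sequence with a stochastic linear bandit with parameter `θstar`:
in each round the arm is sampled from the deployed policy, and the mean reward of the sampled
arm is linear in its context, whatever happened before. Contexts may depend on the past. -/
structure IsLinearBanditInteraction [MeasurableSpace Ω] (μ : Measure Ω)
    (θstar : EuclideanSpace ℝ (Fin d)) (x : ℕ → Ω → Fin K → EuclideanSpace ℝ (Fin d))
    (pol : ℕ → Ω → Fin K → ℝ) (A : ℕ → Ω → Fin K) (R : ℕ → Ω → ℝ) : Prop where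
  measurable_context : ∀ t, 1 ≤ t → Measurable (x t)
  measurable_policy : ∀ t, 1 ≤ t → Measurable (pol t)
  measurable_arm : ∀ t, 1 ≤ t → Measurable (A t)
  measurable_reward : ∀ t, 1 ≤ t → Measurable (R t)
  arm_law : ∀ t, 1 ≤ t → ∀ a : Fin K,
    μ[(A t ⁻¹' {a}).indicator (fun _ => (1 : ℝ)) | policyInfo x pol A R t]
      =ᵐ[μ] fun ω => pol t ω a
  integrable_reward : ∀ t, 1 ≤ t → Integrable (R t) μ
  mean_reward : ∀ t, 1 ≤ t →
    μ[R t | armInfo x pol A R t] =ᵐ[μ] fun ω => inner ℝ θstar (x t ω (A t ω))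

/-- `X` is `σ`-sub-Gaussian conditionally on `m`: its conditional moment generating function
given `m` is dominated by that of a centred Gaussian with variance `σ ^ 2`. -/
def IsCondSubGaussian [MeasurableSpace Ω] (μ : Measure Ω) (m : MeasurableSpace Ω)
    (X : Ω → ℝ) (σ : ℝ) : Prop :=
  ∀ s : ℝ, Integrable (fun ω => Real.exp (s * X ω)) μ ∧
    μ[fun ω => Real.exp (s * X ω) | m] ≤ᵐ[μ] fun _ => Real.exp (s ^ 2 * σ ^ 2 / 2)

/-- The regularized design matrix `V_t = lam • I + ∑_{s < t} x_s x_sᵀ` of the sampled contexts. -/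
def designMatrix (lam : ℝ) (x : ℕ → Ω → Fin K → EuclideanSpace ℝ (Fin d))
    (A : ℕ → Ω → Fin K) (t : ℕ) (ω : Ω) : Matrix (Fin d) (Fin d) ℝ :=
  lam • (1 : Matrix (Fin d) (Fin d) ℝ) +
    ∑ s ∈ Finset.Ico 1 t, Matrix.vecMulVec (x s ω (A s ω)).ofLp (x s ω (A s ω)).ofLp

/-- The vector `b_t = ∑_{s < t} r_s x_s`. -/
def responseVector (x : ℕ → Ω → Fin K → EuclideanSpace ℝ (Fin d))
    (A : ℕ → Ω → Fin K) (R : ℕ → Ω → ℝ) (t : ℕ) (ω : Ω) : Fin d → ℝ :=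
  ∑ s ∈ Finset.Ico 1 t, R s ω • (x s ω (A s ω)).ofLp

/-- The ridge regression estimate `V_t⁻¹ b_t`. -/
def ridgeEstimate (lam : ℝ) (x : ℕ → Ω → Fin K → EuclideanSpace ℝ (Fin d))
    (A : ℕ → Ω → Fin K) (R : ℕ → Ω → ℝ) (t : ℕ) (ω : Ω) : EuclideanSpace ℝ (Fin d) :=
  WithLp.toLp 2 ((designMatrix lam x A t ω)⁻¹.mulVec (responseVector x A R t ω))

/-- The seminorm `√(vᵀ V v)` of a positive semidefinite matrix `V`. -/
def matrixNorm (V : Matrix (Fin d) (Fin d) ℝ) (v : EuclideanSpace ℝ (Fin d)) : ℝ :=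
  Real.sqrt (v.ofLp ⬝ᵥ V.mulVec v.ofLp)

/-- The confidence ellipsoid of round `t` with squared radius `β t`. -/
def confidenceRegion (lam : ℝ) (β : ℕ → ℝ) (x : ℕ → Ω → Fin K → EuclideanSpace ℝ (Fin d))
    (A : ℕ → Ω → Fin K) (R : ℕ → Ω → ℝ) (t : ℕ) (ω : Ω) : Set (EuclideanSpace ℝ (Fin d)) :=
  {θ | matrixNorm (designMatrix lam x A t ω) (θ - ridgeEstimate lam x A R t ω)
    ≤ Real.sqrt (β t)}

/-- `pol` is deployed by FairX-LinUCB with merit function `f`, regularization `lam` and squared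
radii `β`: in each round it is the fair policy of a parameter in the confidence region that
maximizes the expected reward of its own fair policy. Ties may be broken in any way. -/
def IsFairXLinUCB (f : ℝ → ℝ) (lam : ℝ) (β : ℕ → ℝ)
    (x : ℕ → Ω → Fin K → EuclideanSpace ℝ (Fin d)) (pol : ℕ → Ω → Fin K → ℝ)
    (A : ℕ → Ω → Fin K) (R : ℕ → Ω → ℝ) : Prop :=
  ∀ t, 1 ≤ t → ∀ ω, ∃ θ ∈ confidenceRegion lam β x A R t ω,
    IsMaxOn (fun θ' => expectedReward θ' (x t ω) (fairPolicy f θ' (x t ω)))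
      (confidenceRegion lam β x A R t ω) θ ∧
    pol t ω = fairPolicy f θ (x t ω)

end Processes

/-- The squared radius `β_t` used in dimension `d` at confidence level `1 - δ`, for a true
parameter of norm at most `1`. -/
def radius (d : ℕ) (δ : ℝ) (t : ℕ) : ℝ :=
  (1 + Real.sqrt (d * Real.log (1 + t / d) +
    2 * Real.log (Real.pi ^ 2 * t ^ 2 / (3 * δ)))) ^ 2

end

end FairX

/-! The argument is optimism applied to policies. Suppose the confidence ellipsoids contain the true
parameter. The maximizer `θ` of a round then promises at least the optimal fair reward, and it
promises this for the very policy that is deployed. The regret of the round is therefore at most the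
difference of the rewards of one policy under two parameters. This is linear in `θ - θstar`, so the
merit function needs no regularity, and Cauchy-Schwarz in the design geometry bounds it by `2 * √(β
t)` times the policy-averaged width (`expectedReward_sub_le`).

Two concentration facts carry the probability, each failing with probability at most `δ / 2`. For
the ellipsoids, `exp (Sᵀ V⁻¹ S / 2) / √(det V)`, with `S` the noise sum, has mean at most one. Its
one-step inequality is a Gaussian mixture of exponential moments (`lintegral_exp_quadratic_le_one`),
and Markov's inequality in each round gives `measure_notMem_confidenceRegion_le`. For the widths,
the elliptical potential (`sum_width_sq_le`) controls only sampled arms, while the regret involves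
averages over the policy. The multiplicative comparison `measure_sum_meanWidth_gt_le` bridges this
at the cost of a factor two and an additive logarithm.

Cauchy-Schwarz over rounds then bounds the total width by order `√(T d log)`, and the radius
contributes another `√(d log)`. -/

namespace FairX

/-! ### Rank-one updates of positive definite matrices -/

section RankOneUpdate

open Matrix

variable {n : Type*} [Fintype n]

theorem posDef_add_vecMulVec {V : Matrix n n ℝ} (hV : V.PosDef) (x : n → ℝ) :
    (V + vecMulVec x x).PosDef := by
  have h := posSemidef_vecMulVec_self_star x
  rw [star_trivial] at h
  exact hV.add_posSemidef h

variable [DecidableEq n]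

theorem dotProduct_inv_mulVec_comm {V : Matrix n n ℝ} (hV : V.PosDef) (x y : n → ℝ) :
    x ⬝ᵥ V⁻¹ *ᵥ y = y ⬝ᵥ V⁻¹ *ᵥ x := by
  have h : (V⁻¹)ᵀ = V⁻¹ := by
    have := hV.inv.isHermitian.eq
    rwa [conjTranspose_eq_transpose_of_trivial] at this
  rw [dotProduct_comm, ← vecMul_transpose, h, dotProduct_mulVec]

theorem dotProduct_inv_mulVec_nonneg {V : Matrix n n ℝ} (hV : V.PosDef) (x : n → ℝ) :
    0 ≤ x ⬝ᵥ V⁻¹ *ᵥ x := by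
  simpa using hV.inv.posSemidef.dotProduct_mulVec_nonneg x

theorem det_add_vecMulVec_self {V : Matrix n n ℝ} (hV : V.PosDef) (x : n → ℝ) :
    (V + vecMulVec x x).det = V.det * (1 + x ⬝ᵥ V⁻¹ *ᵥ x) := by
  rw [vecMulVec_eq Unit, det_add_replicateCol_mul_replicateRow hV.det_pos.ne'.isUnit]
  congr 1
  rw [det_unique, Matrix.add_apply, one_apply_eq, Matrix.mul_assoc]
  congr 1

/-- The Sherman-Morrison formula, applied to a vector. -/
theorem inv_add_vecMulVec_mulVec {V : Matrix n n ℝ} (hV : V.PosDef) (x y : n → ℝ) :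
    (V + vecMulVec x x)⁻¹ *ᵥ y =
      V⁻¹ *ᵥ y - ((x ⬝ᵥ V⁻¹ *ᵥ y) / (1 + x ⬝ᵥ V⁻¹ *ᵥ x)) • V⁻¹ *ᵥ x := by
  have hu := dotProduct_inv_mulVec_nonneg hV x
  have hV' : IsUnit (V + vecMulVec x x).det := (posDef_add_vecMulVec hV x).det_pos.ne'.isUnit
  have hVV (z : n → ℝ) : V *ᵥ V⁻¹ *ᵥ z = z := by
    rw [mulVec_mulVec, mul_nonsing_inv _ hV.det_pos.ne'.isUnit, one_mulVec]
  have key : (V + vecMulVec x x) *ᵥ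
      (V⁻¹ *ᵥ y - ((x ⬝ᵥ V⁻¹ *ᵥ y) / (1 + x ⬝ᵥ V⁻¹ *ᵥ x)) • V⁻¹ *ᵥ x) = y := by
    rw [add_mulVec, mulVec_sub, mulVec_smul, hVV, hVV, vecMulVec_mulVec, dotProduct_sub,
      dotProduct_smul]
    ext i
    simp only [Pi.add_apply, Pi.sub_apply, Pi.smul_apply, op_smul_eq_smul, smul_eq_mul]
    have : 1 + x ⬝ᵥ V⁻¹ *ᵥ x ≠ 0 := by positivity
    field_simp
    ring
  conv_lhs => rw [← key]
  rw [mulVec_mulVec, nonsing_inv_mul _ hV', one_mulVec]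

/-- Sherman-Morrison in the form needed for one round, with `y` as the noise. Only the scalars `x ⬝ᵥ
V⁻¹ *ᵥ S` and `x ⬝ᵥ V⁻¹ *ᵥ x` enter the increment, so the supermartingale step becomes
one-dimensional. -/
theorem dotProduct_inv_add_vecMulVec_mulVec {V : Matrix n n ℝ} (hV : V.PosDef) (x S : n → ℝ)
    (y : ℝ) :
    (S + y • x) ⬝ᵥ (V + vecMulVec x x)⁻¹ *ᵥ (S + y • x) =
      S ⬝ᵥ V⁻¹ *ᵥ S - (x ⬝ᵥ V⁻¹ *ᵥ S) ^ 2 / (1 + x ⬝ᵥ V⁻¹ *ᵥ x)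
        + 2 * ((x ⬝ᵥ V⁻¹ *ᵥ S) / (1 + x ⬝ᵥ V⁻¹ *ᵥ x)) * y
        + (x ⬝ᵥ V⁻¹ *ᵥ x) / (1 + x ⬝ᵥ V⁻¹ *ᵥ x) * y ^ 2 := by
  have hu := dotProduct_inv_mulVec_nonneg hV x
  rw [inv_add_vecMulVec_mulVec hV]
  simp only [mulVec_add, mulVec_smul, dotProduct_add, add_dotProduct, dotProduct_sub,
    dotProduct_smul, smul_dotProduct, smul_eq_mul]
  rw [dotProduct_inv_mulVec_comm hV S x]
  have : 1 + x ⬝ᵥ V⁻¹ *ᵥ x ≠ 0 := by positivity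
  field_simp
  ring

/-- The inequality of arithmetic and geometric means for the eigenvalues. -/
theorem det_le_trace_div_card_pow [Nonempty n] {V : Matrix n n ℝ} (hV : V.PosDef) :
    V.det ≤ (V.trace / Fintype.card n) ^ Fintype.card n := by
  have hc : (0 : ℝ) < Fintype.card n := by exact_mod_cast Fintype.card_pos
  have hpos (i : n) : 0 ≤ hV.isHermitian.eigenvalues i := (hV.eigenvalues_pos i).le
  have h := Real.geom_mean_le_arith_mean Finset.univ (fun _ : n => (1 : ℝ))
    hV.isHermitian.eigenvalues (fun _ _ => zero_le_one) (by simpa using hc) (fun i _ => hpos i)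
  have hdet := hV.isHermitian.det_eq_prod_eigenvalues
  have htr := hV.isHermitian.trace_eq_sum_eigenvalues
  simp only [RCLike.ofReal_real_eq_id, id_eq] at hdet htr
  simp only [Real.rpow_one, one_mul, Finset.sum_const, Finset.card_univ, nsmul_eq_mul,
    mul_one] at h
  rw [← hdet, ← htr] at h
  calc V.det = (V.det ^ (Fintype.card n : ℝ)⁻¹) ^ Fintype.card n := by
        rw [Real.rpow_inv_natCast_pow hV.det_pos.le (by exact_mod_cast hc.ne')]
    _ ≤ _ := pow_le_pow_left₀ (Real.rpow_nonneg hV.det_pos.le _) h _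

end RankOneUpdate

/-! ### Geometry of the norm given by a matrix -/

section MatrixNorm

open Matrix

variable {d : ℕ} {V : Matrix (Fin d) (Fin d) ℝ}

/-- A factorization `V = Bᵀ * B` transports the triangle and Cauchy-Schwarz inequalities from
Euclidean space. -/
theorem exists_matrixNorm_eq_norm (hV : V.PosSemidef) :
    ∃ B : Matrix (Fin d) (Fin d) ℝ, V = Bᵀ * B ∧
      ∀ v, matrixNorm V v = ‖WithLp.toLp 2 (B *ᵥ v.ofLp)‖ := by
  open scoped MatrixOrder in
  obtain ⟨B, rfl⟩ := CStarAlgebra.nonneg_iff_eq_star_mul_self.mp hV.nonneg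
  rw [star_eq_conjTranspose, conjTranspose_eq_transpose_of_trivial]
  refine ⟨B, rfl, fun v => ?_⟩
  rw [matrixNorm, EuclideanSpace.norm_eq, ← mulVec_mulVec, dotProduct_mulVec, vecMul_transpose]
  simp [dotProduct, sq]

theorem matrixNorm_sub_le (hV : V.PosSemidef) (v w : EuclideanSpace ℝ (Fin d)) :
    matrixNorm V (v - w) ≤ matrixNorm V v + matrixNorm V w := by
  obtain ⟨B, -, hB⟩ := exists_matrixNorm_eq_norm hV
  rw [hB, hB, hB, WithLp.ofLp_sub, mulVec_sub, WithLp.toLp_sub]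
  exact norm_sub_le _ _

theorem dotProduct_mulVec_le_matrixNorm_mul (hV : V.PosSemidef) (v w : EuclideanSpace ℝ (Fin d)) :
    v.ofLp ⬝ᵥ V *ᵥ w.ofLp ≤ matrixNorm V v * matrixNorm V w := by
  obtain ⟨B, rfl, hB⟩ := exists_matrixNorm_eq_norm hV
  rw [hB, hB, ← mulVec_mulVec, dotProduct_mulVec, vecMul_transpose, dotProduct_comm]
  simpa [EuclideanSpace.inner_eq_star_dotProduct] using
    real_inner_le_norm (WithLp.toLp 2 (B *ᵥ v.ofLp)) (WithLp.toLp 2 (B *ᵥ w.ofLp))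

theorem matrixNorm_inv_mulVec (hV : V.PosDef) (v : Fin d → ℝ) :
    matrixNorm V (WithLp.toLp 2 (V⁻¹ *ᵥ v)) = √(v ⬝ᵥ V⁻¹ *ᵥ v) := by
  rw [matrixNorm]
  simp only [mulVec_mulVec, mul_nonsing_inv _ hV.det_pos.ne'.isUnit, one_mulVec]
  rw [dotProduct_comm]

theorem inner_le_matrixNorm_mul (hV : V.PosDef) (v x : EuclideanSpace ℝ (Fin d)) :
    inner ℝ v x ≤ matrixNorm V v * √(x.ofLp ⬝ᵥ V⁻¹ *ᵥ x.ofLp) := by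
  have h := dotProduct_mulVec_le_matrixNorm_mul hV.posSemidef v (WithLp.toLp 2 (V⁻¹ *ᵥ x.ofLp))
  rw [matrixNorm_inv_mulVec hV] at h
  simp only [mulVec_mulVec, mul_nonsing_inv _ hV.det_pos.ne'.isUnit, one_mulVec] at h
  refine le_trans (le_of_eq ?_) h
  rw [EuclideanSpace.inner_eq_star_dotProduct, star_trivial, dotProduct_comm]

/-- Put `y = V⁻¹ x` and `u = xᵀ V⁻¹ x = yᵀ V y`. From `V ≥ 1` one gets `‖y‖ ^ 2 ≤ u`, and `u = ⟪y,
x⟫ ≤ ‖y‖`; together `u ^ 2 ≤ u`. -/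
theorem dotProduct_inv_mulVec_le_one (hV : V.PosDef) (hV1 : (V - 1).PosSemidef)
    (x : EuclideanSpace ℝ (Fin d)) (hx : ‖x‖ ≤ 1) : x.ofLp ⬝ᵥ V⁻¹ *ᵥ x.ofLp ≤ 1 := by
  set u := x.ofLp ⬝ᵥ V⁻¹ *ᵥ x.ofLp with hu
  set y : EuclideanSpace ℝ (Fin d) := WithLp.toLp 2 (V⁻¹ *ᵥ x.ofLp) with hy
  have hu0 : 0 ≤ u := dotProduct_inv_mulVec_nonneg hV _
  have h1 : ‖y‖ ^ 2 ≤ u := by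
    have h := hV1.dotProduct_mulVec_nonneg y.ofLp
    rw [star_trivial, sub_mulVec, one_mulVec, dotProduct_sub, hy] at h
    simp only [mulVec_mulVec, mul_nonsing_inv _ hV.det_pos.ne'.isUnit, one_mulVec] at h
    rw [dotProduct_comm] at h
    rw [EuclideanSpace.real_norm_sq_eq, hy]
    simp only [dotProduct, ← sq] at h
    simp only [hu, dotProduct]
    linarith
  have h2 : u ≤ ‖y‖ := by
    have h := real_inner_le_norm y x
    have h' : inner ℝ y x = u := by
      rw [EuclideanSpace.inner_eq_star_dotProduct, star_trivial]
    nlinarith [norm_nonneg y]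
  nlinarith [norm_nonneg y]

end MatrixNorm

/-! ### Gaussian mixtures and conditional exponential moments -/

section MethodOfMixtures

open ProbabilityTheory
open scoped ENNReal NNReal

/-- A Gaussian mixture of exponential moments, bounded through the moments themselves. -/
theorem lintegral_exp_quadratic_le_one (ν : Measure ℝ) [IsProbabilityMeasure ν]
    (hν : ∀ s : ℝ, ∫⁻ y, ENNReal.ofReal (Real.exp (s * y)) ∂ν
      ≤ ENNReal.ofReal (Real.exp (s ^ 2 / 2))) (w : ℝ) {u : ℝ} (hu : 0 ≤ u) :
    ∫⁻ y, ENNReal.ofReal (Real.exp (-(w ^ 2 / (2 * (1 + u))) + w / (1 + u) * y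
      + u / (1 + u) * y ^ 2 / 2) / √(1 + u)) ∂ν ≤ 1 := by
  -- For `u = 0` the mixing Gaussian degenerates to a point mass without density, so this case uses
  -- the moment bound at `s = w` alone.
  rcases hu.eq_or_lt with rfl | hu
  · simp only [add_zero, mul_one, div_one, zero_div, zero_mul, Real.sqrt_one]
    simp_rw [Real.exp_add, ENNReal.ofReal_mul (Real.exp_nonneg _)]
    rw [lintegral_const_mul _ (by fun_prop)]
    calc _ ≤ ENNReal.ofReal (Real.exp (-(w ^ 2 / 2))) * ENNReal.ofReal (Real.exp (w ^ 2 / 2)) := by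
          gcongr; exact hν w
      _ = 1 := by
          rw [← ENNReal.ofReal_mul (Real.exp_nonneg _), ← Real.exp_add]; simp
  have hu1 : 0 < 1 + u := by positivity
  set v : ℝ≥0 := ⟨u / (1 + u), by positivity⟩ with hv
  have hvr : (v : ℝ) = u / (1 + u) := rfl
  have hv0 : v ≠ 0 := by
    intro h
    have : (v : ℝ) = 0 := by rw [h]; rfl
    rw [hvr] at this
    have : 0 < u / (1 + u) := by positivity
    linarith
  set v' : ℝ≥0 := ⟨u, hu.le⟩ with hv'
  have hvr' : (v' : ℝ) = u := rfl
  have hv0' : v' ≠ 0 := by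
    intro h
    have : (v' : ℝ) = 0 := by rw [h]; rfl
    linarith
  set b := w / (1 + u) with hb
  set k := Real.exp (-(w ^ 2 / (2 * (1 + u)))) / √(1 + u) with hk
  have hk0 : 0 ≤ k := by positivity
  -- Completing the square in `s`: the quadratic exponential in `y` is the mean of `exp (s * y)` for
  -- `s` Gaussian with mean `b = w / (1 + u)` and variance `v = u / (1 + u)`.
  have square (y s : ℝ) : Real.exp (b * y + u / (1 + u) * y ^ 2 / 2) *
      gaussianPDFReal (b + u / (1 + u) * y) v s
      = Real.exp (s * y) * gaussianPDFReal b v s := by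
    simp only [gaussianPDFReal, hvr]
    rw [mul_left_comm, mul_left_comm (Real.exp (s * y)), ← Real.exp_add, ← Real.exp_add]
    congr 2
    field_simp
    ring
  -- Once `exp (s * y)` is integrated out and replaced by `exp (s ^ 2 / 2)`, the prefactor `k`
  -- normalizes the result exactly to the density with mean `w` and variance `u`.
  have absorb (s : ℝ) : k * (gaussianPDFReal b v s * Real.exp (s ^ 2 / 2))
      = gaussianPDFReal w v' s := by
    simp only [gaussianPDFReal, hvr, hvr', hk, hb]
    have : √(2 * Real.pi * u) = √(1 + u) * √(2 * Real.pi * (u / (1 + u))) := by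
      rw [← Real.sqrt_mul hu1.le]
      congr 1
      field_simp
    rw [this, mul_inv]
    rw [show ∀ a b c e f : ℝ, a / b * (c * e * f) = b⁻¹ * c * (a * (e * f)) by intros; ring,
      ← Real.exp_add, ← Real.exp_add]
    congr 2
    field_simp
    ring
  have mix (y : ℝ) : ENNReal.ofReal (Real.exp (-(w ^ 2 / (2 * (1 + u))) + b * y
      + u / (1 + u) * y ^ 2 / 2) / √(1 + u))
      = ENNReal.ofReal k * ∫⁻ s, gaussianPDF b v s * ENNReal.ofReal (Real.exp (s * y)) := by
    have : ∫⁻ s, gaussianPDF b v s * ENNReal.ofReal (Real.exp (s * y))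
        = ENNReal.ofReal (Real.exp (b * y + u / (1 + u) * y ^ 2 / 2)) := by
      rw [← mul_one (ENNReal.ofReal _),
        ← lintegral_gaussianPDF_eq_one (b + u / (1 + u) * y) hv0,
        ← lintegral_const_mul _ (measurable_gaussianPDF _ _)]
      refine lintegral_congr fun s => ?_
      rw [gaussianPDF, gaussianPDF, ← ENNReal.ofReal_mul (Real.exp_nonneg _), square,
        mul_comm, ENNReal.ofReal_mul (Real.exp_nonneg _)]
    rw [this, ← ENNReal.ofReal_mul hk0, hk, add_assoc, Real.exp_add]
    congr 1
    ring
  simp_rw [mix]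
  have hm : Measurable (fun p : ℝ × ℝ =>
      gaussianPDF b v p.2 * ENNReal.ofReal (Real.exp (p.2 * p.1))) :=
    ((measurable_gaussianPDF b v).comp measurable_snd).mul (by fun_prop)
  rw [lintegral_const_mul _ hm.lintegral_prod_right', lintegral_lintegral_swap hm.aemeasurable]
  calc _ ≤ ENNReal.ofReal k *
        ∫⁻ s, gaussianPDF b v s * ENNReal.ofReal (Real.exp (s ^ 2 / 2)) := by
        gcongr with s
        change ∫⁻ y, gaussianPDF b v s * ENNReal.ofReal (Real.exp (s * y)) ∂ν ≤ _
        rw [lintegral_const_mul _ (by fun_prop)]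
        gcongr
        exact hν s
    _ = ∫⁻ s, gaussianPDF w v' s := by
        have hbv : Measurable fun s => gaussianPDF b v s * ENNReal.ofReal (Real.exp (s ^ 2 / 2)) :=
          (measurable_gaussianPDF b v).mul (by fun_prop)
        rw [← lintegral_const_mul _ hbv]
        refine lintegral_congr fun s => ?_
        rw [gaussianPDF, gaussianPDF, ← absorb, ENNReal.ofReal_mul hk0,
          ENNReal.ofReal_mul (gaussianPDFReal_nonneg _ _ _)]
    _ = 1 := lintegral_gaussianPDF_eq_one w hv0'

variable {Ω α : Type*} [MeasurableSpace Ω] {mα : MeasurableSpace α} {μ : Measure Ω}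
  [IsProbabilityMeasure μ] {X : Ω → α} {Y : Ω → ℝ}

/-- The exceptional null set of the hypothesis depends on `s`. Rational `s` give one common null
set, and Fatou's lemma along rationals tending to `s` extends the bound to all reals. -/
theorem ae_lintegral_exp_condDistrib_le (hX : Measurable X) (hY : Measurable Y)
    (h : IsCondSubGaussian μ (mα.comap X) Y 1) :
    ∀ᵐ ω ∂μ, ∀ s : ℝ, ∫⁻ y, ENNReal.ofReal (Real.exp (s * y)) ∂condDistrib Y X μ (X ω)
      ≤ ENNReal.ofReal (Real.exp (s ^ 2 / 2)) := by
  have hrat : ∀ᵐ ω ∂μ, ∀ q : ℚ,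
      ∫⁻ y, ENNReal.ofReal (Real.exp (q * y)) ∂condDistrib Y X μ (X ω)
        ≤ ENNReal.ofReal (Real.exp ((q : ℝ) ^ 2 / 2)) := by
    rw [ae_all_iff]
    intro q
    obtain ⟨hint, hle⟩ := h q
    have hmeas : Measurable fun y : ℝ => Real.exp (q * y) := by fun_prop
    have hint' : Integrable (fun p : α × ℝ => Real.exp (q * p.2)) (μ.map fun a => (X a, Y a)) := by
      rw [integrable_map_measure (by fun_prop) (hX.prodMk hY).aemeasurable]
      exact hint
    have hcond := condExp_ae_eq_integral_condDistrib hX hY.aemeasurable hmeas.stronglyMeasurable hint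
    filter_upwards [hle, hcond, hint'.condDistrib_ae hX.aemeasurable hY.aemeasurable]
      with ω h1 h2 h3
    rw [← ofReal_integral_eq_lintegral_ofReal h3 (ae_of_all _ fun _ => Real.exp_nonneg _)]
    refine ENNReal.ofReal_le_ofReal ?_
    simp only [one_pow, mul_one] at h1
    exact h2 ▸ h1
  filter_upwards [hrat] with ω hω s
  obtain ⟨q, -, -, hq⟩ := Real.exists_seq_rat_strictMono_tendsto s
  have hlim (y : ℝ) : Filter.Tendsto (fun n => ENNReal.ofReal (Real.exp (q n * y))) Filter.atTop
      (nhds (ENNReal.ofReal (Real.exp (s * y)))) :=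
    ENNReal.tendsto_ofReal ((Real.continuous_exp.tendsto _).comp (hq.mul_const y))
  have hlim' : Filter.Tendsto (fun n => ENNReal.ofReal (Real.exp ((q n : ℝ) ^ 2 / 2))) Filter.atTop
      (nhds (ENNReal.ofReal (Real.exp (s ^ 2 / 2)))) :=
    ENNReal.tendsto_ofReal ((Real.continuous_exp.tendsto _).comp ((hq.pow 2).div_const 2))
  calc _ = ∫⁻ y, Filter.liminf (fun n => ENNReal.ofReal (Real.exp (q n * y))) Filter.atTop
        ∂condDistrib Y X μ (X ω) := lintegral_congr fun y => (hlim y).liminf_eq.symm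
    _ ≤ Filter.liminf (fun n => ∫⁻ y, ENNReal.ofReal (Real.exp (q n * y))
        ∂condDistrib Y X μ (X ω)) Filter.atTop := lintegral_liminf_le fun n => by fun_prop
    _ ≤ Filter.liminf (fun n => ENNReal.ofReal (Real.exp ((q n : ℝ) ^ 2 / 2))) Filter.atTop :=
        Filter.liminf_le_liminf (Filter.Eventually.of_forall fun n => hω (q n))
    _ = _ := hlim'.liminf_eq

theorem lintegral_mul_comp_le_of_condDistrib (hX : Measurable X)
    (hY : Measurable Y) {Z : α → ℝ≥0∞} (hZ : Measurable Z) {G : α × ℝ → ℝ≥0∞} (hG : Measurable G)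
    (hle : ∀ᵐ ω ∂μ, ∫⁻ y, G (X ω, y) ∂condDistrib Y X μ (X ω) ≤ 1) :
    ∫⁻ ω, Z (X ω) * G (X ω, Y ω) ∂μ ≤ ∫⁻ ω, Z (X ω) ∂μ := by
  have hF : Measurable fun p : α × ℝ => Z p.1 * G p := (hZ.comp measurable_fst).mul hG
  have hκ : Measurable fun a => ∫⁻ y, Z a * G (a, y) ∂condDistrib Y X μ a :=
    hF.lintegral_kernel_prod_right'
  calc ∫⁻ ω, Z (X ω) * G (X ω, Y ω) ∂μ = ∫⁻ p, Z p.1 * G p ∂(μ.map fun ω => (X ω, Y ω)) :=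
        (lintegral_map hF (hX.prodMk hY)).symm
    _ = ∫⁻ ω, ∫⁻ y, Z (X ω) * G (X ω, y) ∂condDistrib Y X μ (X ω) ∂μ := by
        rw [← compProd_map_condDistrib hY.aemeasurable, Measure.lintegral_compProd hF,
          lintegral_map hκ hX]
    _ ≤ ∫⁻ ω, Z (X ω) ∂μ := by
        refine lintegral_mono_ae ?_
        filter_upwards [hle] with ω hω
        refine (lintegral_const_mul _ (hG.comp measurable_prodMk_left)).trans_le ?_
        exact mul_le_of_le_one_right' hω

theorem lintegral_mul_exp_quadratic_comp_le (hX : Measurable X) (hY : Measurable Y)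
    (h : IsCondSubGaussian μ (mα.comap X) Y 1) {Z : α → ℝ≥0∞} {w u : α → ℝ}
    (hZ : Measurable Z) (hw : Measurable w) (hu : Measurable u) (hu0 : ∀ a, 0 ≤ u a) :
    ∫⁻ ω, Z (X ω) * ENNReal.ofReal (Real.exp (-(w (X ω) ^ 2 / (2 * (1 + u (X ω))))
      + w (X ω) / (1 + u (X ω)) * Y ω + u (X ω) / (1 + u (X ω)) * Y ω ^ 2 / 2)
        / √(1 + u (X ω))) ∂μ ≤ ∫⁻ ω, Z (X ω) ∂μ := by
  refine lintegral_mul_comp_le_of_condDistrib hX hY hZ (G := fun p =>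
    ENNReal.ofReal (Real.exp (-(w p.1 ^ 2 / (2 * (1 + u p.1))) + w p.1 / (1 + u p.1) * p.2
      + u p.1 / (1 + u p.1) * p.2 ^ 2 / 2) / √(1 + u p.1))) (by fun_prop) ?_
  filter_upwards [ae_lintegral_exp_condDistrib_le hX hY h] with ω hω
  exact lintegral_exp_quadratic_le_one _ hω _ (hu0 _)

end MethodOfMixtures

/-! ### Conditioning on a sub-σ-algebra -/

section Conditional

open scoped ENNReal

variable {Ω : Type*} {m mΩ : MeasurableSpace Ω} {μ : Measure Ω}

/-- Markov's inequality for a nonnegative variable with mean at most one. -/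
theorem measure_inv_le_le_ofReal {F : Ω → ℝ} {ε : ℝ} (hε : 0 < ε)
    (hF : AEMeasurable (fun ω => ENNReal.ofReal (F ω)) μ)
    (hint : ∫⁻ ω, ENNReal.ofReal (F ω) ∂μ ≤ 1) :
    μ {ω | ε⁻¹ ≤ F ω} ≤ ENNReal.ofReal ε := by
  calc μ {ω | ε⁻¹ ≤ F ω} ≤ μ {ω | ENNReal.ofReal ε⁻¹ ≤ ENNReal.ofReal (F ω)} :=
        measure_mono fun ω hω => ENNReal.ofReal_le_ofReal hω
    _ ≤ (∫⁻ ω, ENNReal.ofReal (F ω) ∂μ) / ENNReal.ofReal ε⁻¹ :=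
        meas_ge_le_lintegral_div hF (by simpa using hε) ENNReal.ofReal_ne_top
    _ ≤ 1 / ENNReal.ofReal ε⁻¹ := by gcongr
    _ = ENNReal.ofReal ε := by rw [ENNReal.ofReal_inv_of_pos hε, one_div, inv_inv]

variable [IsProbabilityMeasure μ]

/-- The identity, seen as a map into `Ω` with the smaller σ-algebra `m`, is a random variable
generating `m`; this reduces the claim to conditioning on a variable. -/
theorem lintegral_mul_exp_quadratic_le (hm : m ≤ mΩ) {Y : Ω → ℝ} (hY : Measurable Y)
    (h : IsCondSubGaussian μ m Y 1) {Z : Ω → ℝ≥0∞} {w u : Ω → ℝ}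
    (hZ : Measurable[m] Z) (hw : Measurable[m] w) (hu : Measurable[m] u) (hu0 : ∀ ω, 0 ≤ u ω) :
    ∫⁻ ω, Z ω * ENNReal.ofReal (Real.exp (-(w ω ^ 2 / (2 * (1 + u ω))) + w ω / (1 + u ω) * Y ω
      + u ω / (1 + u ω) * Y ω ^ 2 / 2) / √(1 + u ω)) ∂μ ≤ ∫⁻ ω, Z ω ∂μ := by
  refine lintegral_mul_exp_quadratic_comp_le (mα := m) (X := id) (measurable_id'' hm) hY ?_
    hZ hw hu hu0
  rwa [MeasurableSpace.comap_id]

/-- The restriction of `μ` to `s` and the measure with density `p` agree on `m`, hence integrate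
every `m`-measurable function alike. No integrability of `H` is needed. -/
theorem setLIntegral_eq_lintegral_mul_of_condExp_indicator (hm : m ≤ mΩ) {s : Set Ω}
    (hs : MeasurableSet s) {p : Ω → ℝ} (hp : Measurable[m] p) (hp0 : ∀ ω, 0 ≤ p ω)
    (h : μ[s.indicator (fun _ => (1 : ℝ)) | m] =ᵐ[μ] p) {H : Ω → ℝ≥0∞} (hH : Measurable[m] H) :
    ∫⁻ ω in s, H ω ∂μ = ∫⁻ ω, H ω * ENNReal.ofReal (p ω) ∂μ := by
  have hpm : Measurable p := hp.mono hm le_rfl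
  have htrim : (μ.restrict s).trim hm = (μ.withDensity fun ω => ENNReal.ofReal (p ω)).trim hm := by
    refine @Measure.ext _ m _ _ fun t ht => ?_
    have hint : Integrable (s.indicator fun _ => (1 : ℝ)) μ :=
      (integrable_const (1 : ℝ)).indicator hs
    rw [trim_measurableSet_eq hm ht, trim_measurableSet_eq hm ht, withDensity_apply _ (hm t ht),
      Measure.restrict_apply (hm t ht), ← ofReal_integral_eq_lintegral_ofReal
        (integrable_condExp.congr h).integrableOn (ae_of_all _ hp0),
      ← setIntegral_congr_ae (hm t ht) (h.mono fun ω hω _ => hω), setIntegral_condExp hm hint ht,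
      setIntegral_indicator hs]
    simp
  rw [← lintegral_trim hm hH, htrim, lintegral_trim hm hH,
    lintegral_withDensity_eq_lintegral_mul _ hpm.ennreal_ofReal (hH.mono hm le_rfl)]
  simp [mul_comm]

theorem lintegral_comp_eq_of_condExp_indicator {K : ℕ} (hm : m ≤ mΩ) {a : Ω → Fin K}
    (ha : Measurable a) {p : Ω → Fin K → ℝ} (hp : Measurable[m] p) (hp0 : ∀ ω b, 0 ≤ p ω b)
    (h : ∀ b, μ[(a ⁻¹' {b}).indicator (fun _ => (1 : ℝ)) | m] =ᵐ[μ] fun ω => p ω b)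
    {H : Fin K → Ω → ℝ≥0∞} (hH : ∀ b, Measurable[m] (H b)) :
    ∫⁻ ω, H (a ω) ω ∂μ = ∫⁻ ω, ∑ b, H b ω * ENNReal.ofReal (p ω b) ∂μ := by
  have hs (b : Fin K) : MeasurableSet (a ⁻¹' {b}) := ha (measurableSet_singleton b)
  have hpb (b : Fin K) : Measurable[m] fun ω => p ω b := (measurable_pi_apply b).comp hp
  have hHp (b : Fin K) : Measurable fun ω => H b ω * ENNReal.ofReal (p ω b) :=
    ((hH b).mono hm le_rfl).mul ((hpb b).mono hm le_rfl).ennreal_ofReal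
  have hsplit (ω : Ω) : H (a ω) ω = ∑ b, (a ⁻¹' {b}).indicator (H b) ω := by
    rw [Finset.sum_eq_single (a ω)]
    · simp
    · intro b _ hb
      exact Set.indicator_of_notMem (s := a ⁻¹' {b}) (fun hmem => hb (Eq.symm hmem)) (H b)
    · simp
  simp_rw [hsplit]
  rw [lintegral_finsetSum _ fun b _ => ((hH b).mono hm le_rfl).indicator (hs b),
    lintegral_finsetSum _ fun b _ => hHp b]
  refine Finset.sum_congr rfl fun b _ => ?_
  rw [lintegral_indicator (hs b)]
  exact setLIntegral_eq_lintegral_mul_of_condExp_indicator hm (hs b) (hpb b)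
    (fun ω => hp0 ω b) (h b) (hH b)

end Conditional

/-! ### Design matrix, widths and optimism -/

section Design

open Matrix

variable {Ω : Type*} {d K : ℕ} {x : ℕ → Ω → Fin K → EuclideanSpace ℝ (Fin d)}
  {pol : ℕ → Ω → Fin K → ℝ} {A : ℕ → Ω → Fin K} {R : ℕ → Ω → ℝ}
  {θstar : EuclideanSpace ℝ (Fin d)} {ω : Ω}

/-- The martingale `∑_{s < t} η_s x_s`. -/
noncomputable def noiseSum (θstar : EuclideanSpace ℝ (Fin d))
    (x : ℕ → Ω → Fin K → EuclideanSpace ℝ (Fin d)) (A : ℕ → Ω → Fin K) (R : ℕ → Ω → ℝ)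
    (t : ℕ) (ω : Ω) : Fin d → ℝ :=
  ∑ s ∈ Finset.Ico 1 t, noise θstar x A R s ω • (x s ω (A s ω)).ofLp

/-- The norm of the context of arm `a` with respect to the inverse design matrix. -/
noncomputable def width (x : ℕ → Ω → Fin K → EuclideanSpace ℝ (Fin d)) (A : ℕ → Ω → Fin K)
    (t : ℕ) (ω : Ω) (a : Fin K) : ℝ :=
  √((x t ω a).ofLp ⬝ᵥ (designMatrix 1 x A t ω)⁻¹ *ᵥ (x t ω a).ofLp)

/-- The mean width of the arm drawn from the policy. -/
noncomputable def meanWidth (x : ℕ → Ω → Fin K → EuclideanSpace ℝ (Fin d))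
    (pol : ℕ → Ω → Fin K → ℝ) (A : ℕ → Ω → Fin K) (t : ℕ) (ω : Ω) : ℝ :=
  ∑ a, pol t ω a * width x A t ω a

theorem designMatrix_one_one : designMatrix 1 x A 1 ω = 1 := by
  simp [designMatrix]

theorem designMatrix_succ (lam : ℝ) {t : ℕ} (ht : 1 ≤ t) :
    designMatrix lam x A (t + 1) ω =
      designMatrix lam x A t ω + vecMulVec (x t ω (A t ω)).ofLp (x t ω (A t ω)).ofLp := by
  rw [designMatrix, designMatrix, Finset.sum_Ico_succ_top ht, add_assoc]

theorem noiseSum_succ {t : ℕ} (ht : 1 ≤ t) :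
    noiseSum θstar x A R (t + 1) ω =
      noiseSum θstar x A R t ω + noise θstar x A R t ω • (x t ω (A t ω)).ofLp := by
  rw [noiseSum, noiseSum, Finset.sum_Ico_succ_top ht]

theorem posSemidef_designMatrix_sub_one (t : ℕ) : (designMatrix 1 x A t ω - 1).PosSemidef := by
  rw [designMatrix, one_smul, add_sub_cancel_left]
  refine posSemidef_sum _ fun s _ => ?_
  have h := posSemidef_vecMulVec_self_star (x s ω (A s ω)).ofLp
  rwa [star_trivial] at h

theorem posDef_designMatrix (t : ℕ) : (designMatrix 1 x A t ω).PosDef := by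
  have h := PosDef.one.add_posSemidef (posSemidef_designMatrix_sub_one (x := x) (A := A) (ω := ω) t)
  rwa [add_sub_cancel] at h

theorem width_nonneg (t : ℕ) (a : Fin K) : 0 ≤ width x A t ω a := Real.sqrt_nonneg _

theorem width_le_one {t : ℕ} {a : Fin K} (hx : ‖x t ω a‖ ≤ 1) : width x A t ω a ≤ 1 := by
  rw [width, Real.sqrt_le_one]
  exact dotProduct_inv_mulVec_le_one (posDef_designMatrix t) (posSemidef_designMatrix_sub_one t) _ hx

theorem det_designMatrix_succ_le (hd : 0 < d) (hx : ∀ t, 1 ≤ t → ∀ a, ‖x t ω a‖ ≤ 1) (t : ℕ) :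
    (designMatrix 1 x A (t + 1) ω).det ≤ (1 + t / d : ℝ) ^ d := by
  have : Nonempty (Fin d) := ⟨⟨0, hd⟩⟩
  have hd' : (0 : ℝ) < d := by exact_mod_cast hd
  refine (det_le_trace_div_card_pow (posDef_designMatrix (t + 1))).trans ?_
  rw [Fintype.card_fin]
  have htr : (designMatrix 1 x A (t + 1) ω).trace ≤ d + t := by
    rw [designMatrix, one_smul, trace_add, trace_one, Fintype.card_fin, trace_sum]
    gcongr
    calc _ ≤ ∑ s ∈ Finset.Ico 1 (t + 1), (1 : ℝ) := by
          refine Finset.sum_le_sum fun s hs => ?_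
          rw [trace_vecMulVec]
          have h := hx s (Finset.mem_Ico.1 hs).1 (A s ω)
          have h2 : (x s ω (A s ω)).ofLp ⬝ᵥ (x s ω (A s ω)).ofLp = ‖x s ω (A s ω)‖ ^ 2 := by
            rw [EuclideanSpace.real_norm_sq_eq]
            simp [dotProduct, sq]
          rw [h2]
          exact pow_le_one₀ (norm_nonneg _) h
      _ = t := by simp
  have h0 : 0 ≤ (designMatrix 1 x A (t + 1) ω).trace :=
    (posDef_designMatrix (t + 1)).posSemidef.trace_nonneg
  refine pow_le_pow_left₀ (by positivity) ?_ _
  rw [div_le_iff₀ hd', add_mul, div_mul_cancel₀ _ hd'.ne', one_mul]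
  exact htr

theorem det_designMatrix_eq_prod (T : ℕ) :
    (designMatrix 1 x A (T + 1) ω).det =
      ∏ t ∈ Finset.Icc 1 T, (1 + width x A t ω (A t ω) ^ 2) := by
  induction T with
  | zero => simp [designMatrix_one_one]
  | succ T ih =>
    rw [designMatrix_succ 1 (by omega), det_add_vecMulVec_self (posDef_designMatrix _), ih,
      Finset.prod_Icc_succ_top (by omega), width,
      Real.sq_sqrt (dotProduct_inv_mulVec_nonneg (posDef_designMatrix _) _)]

/-- The elliptical potential lemma. -/
theorem sum_width_sq_le (hd : 0 < d) (hx : ∀ t, 1 ≤ t → ∀ a, ‖x t ω a‖ ≤ 1) (T : ℕ) :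
    ∑ t ∈ Finset.Icc 1 T, width x A t ω (A t ω) ^ 2 ≤ 2 * (d * Real.log (1 + T / d)) := by
  -- This is where squared widths being at most one is used; the bound fails for large `u`.
  have hlog {u : ℝ} (h0 : 0 ≤ u) (h1 : u ≤ 1) : u ≤ 2 * Real.log (1 + u) := by
    have h := Real.one_sub_inv_le_log_of_pos (by positivity : 0 < 1 + u)
    have h2 : u / 2 ≤ 1 - (1 + u)⁻¹ := by
      rw [show 1 - (1 + u)⁻¹ = u / (1 + u) by field_simp; ring]
      gcongr
      linarith
    linarith
  calc _ ≤ ∑ t ∈ Finset.Icc 1 T, 2 * Real.log (1 + width x A t ω (A t ω) ^ 2) := by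
        refine Finset.sum_le_sum fun t ht => hlog (sq_nonneg _) ?_
        exact pow_le_one₀ (width_nonneg _ _) (width_le_one (hx t (Finset.mem_Icc.1 ht).1 _))
    _ = 2 * Real.log (designMatrix 1 x A (T + 1) ω).det := by
        rw [det_designMatrix_eq_prod, Real.log_prod fun t _ => by positivity, Finset.mul_sum]
    _ ≤ 2 * Real.log ((1 + T / d : ℝ) ^ d) := by
        gcongr
        · exact (posDef_designMatrix _).det_pos
        · exact det_designMatrix_succ_le hd hx T
    _ = _ := by rw [Real.log_pow]

theorem responseVector_eq (t : ℕ) :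
    responseVector x A R t ω =
      designMatrix 1 x A t ω *ᵥ θstar.ofLp - θstar.ofLp + noiseSum θstar x A R t ω := by
  rw [responseVector, designMatrix, one_smul, add_mulVec, one_mulVec, add_sub_cancel_left,
    sum_mulVec, noiseSum, ← Finset.sum_add_distrib]
  refine Finset.sum_congr rfl fun s _ => ?_
  rw [vecMulVec_mulVec, noise, EuclideanSpace.inner_eq_star_dotProduct, star_trivial, sub_smul]
  simp

/-- The estimation error is `V⁻¹ θstar - V⁻¹ S`. The first term is the ridge bias, at most one
because `V ≥ 1`; it accounts for the leading `1` in `radius`. -/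
theorem matrixNorm_sub_ridgeEstimate_le (hθ : ‖θstar‖ ≤ 1) (t : ℕ) :
    matrixNorm (designMatrix 1 x A t ω) (θstar - ridgeEstimate 1 x A R t ω) ≤
      1 + √(noiseSum θstar x A R t ω ⬝ᵥ
        (designMatrix 1 x A t ω)⁻¹ *ᵥ noiseSum θstar x A R t ω) := by
  have hV : (designMatrix 1 x A t ω).PosDef := posDef_designMatrix t
  have heq : θstar - ridgeEstimate 1 x A R t ω =
      WithLp.toLp 2 ((designMatrix 1 x A t ω)⁻¹ *ᵥ θstar.ofLp) -
        WithLp.toLp 2 ((designMatrix 1 x A t ω)⁻¹ *ᵥ noiseSum θstar x A R t ω) := by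
    rw [ridgeEstimate, responseVector_eq (θstar := θstar), mulVec_add, mulVec_sub, mulVec_mulVec,
      nonsing_inv_mul _ hV.det_pos.ne'.isUnit, one_mulVec]
    ext i
    simp
    ring
  rw [heq]
  refine (matrixNorm_sub_le hV.posSemidef _ _).trans ?_
  rw [matrixNorm_inv_mulVec hV, matrixNorm_inv_mulVec hV]
  gcongr
  rw [Real.sqrt_le_one]
  exact dotProduct_inv_mulVec_le_one hV (posSemidef_designMatrix_sub_one t) _ hθ

/-- Optimism replaces the optimal fair reward by the value of `θ` under its own fair policy, which
is the deployed one. What remains is linear in `θ - θstar`, a difference of two points of the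
ellipsoid. -/
theorem expectedReward_sub_le {f : ℝ → ℝ} (hf : ∀ z, 0 < f z) {β : ℕ → ℝ}
    (h : IsFairXLinUCB f 1 β x pol A R) {t : ℕ} (ht : 1 ≤ t)
    (hθ : θstar ∈ confidenceRegion 1 β x A R t ω) :
    expectedReward θstar (x t ω) (fairPolicy f θstar (x t ω)) -
      expectedReward θstar (x t ω) (pol t ω) ≤ 2 * √(β t) * meanWidth x pol A t ω := by
  obtain ⟨θ, hθt, hmax, hpol⟩ := h t ht ω
  have hV : (designMatrix 1 x A t ω).PosDef := posDef_designMatrix t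
  have hpos (a : Fin K) : 0 ≤ pol t ω a := by
    rw [hpol]
    exact div_nonneg (hf _).le (Finset.sum_nonneg fun b _ => (hf _).le)
  have hdist : matrixNorm (designMatrix 1 x A t ω) (θ - θstar) ≤ 2 * √(β t) := by
    rw [← sub_sub_sub_cancel_right θ θstar (ridgeEstimate 1 x A R t ω)]
    refine (matrixNorm_sub_le hV.posSemidef _ _).trans ?_
    rw [two_mul]
    exact add_le_add hθt hθ
  calc _ ≤ expectedReward θ (x t ω) (pol t ω) - expectedReward θstar (x t ω) (pol t ω) := by
        rw [hpol]
        exact sub_le_sub_right (hmax hθ) _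
    _ = ∑ a, pol t ω a * inner ℝ (θ - θstar) (x t ω a) := by
        rw [expectedReward, expectedReward, ← Finset.sum_sub_distrib]
        refine Finset.sum_congr rfl fun a _ => ?_
        rw [inner_sub_left, mul_sub]
    _ ≤ ∑ a, pol t ω a * (2 * √(β t) * width x A t ω a) := by
        gcongr with a
        · exact hpos a
        · exact (inner_le_matrixNorm_mul hV _ _).trans
            (mul_le_mul_of_nonneg_right hdist (width_nonneg _ _))
    _ = _ := by
        rw [meanWidth, Finset.mul_sum]
        refine Finset.sum_congr rfl fun a _ => ?_
        ring

end Design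

/-! ### Measurability of the design quantities -/

section Measurability

open Matrix

variable {Ω : Type*} {m : MeasurableSpace Ω} {n : Type*} [Fintype n] [DecidableEq n]

theorem measurable_det {V : Ω → Matrix n n ℝ} (hV : ∀ i j, Measurable fun ω => V ω i j) :
    Measurable fun ω => (V ω).det := by
  simp_rw [det_apply']
  exact Finset.measurable_fun_sum _ fun σ _ =>
    measurable_const.mul (Finset.measurable_fun_prod _ fun i _ => hV _ _)

theorem measurable_inv_apply {V : Ω → Matrix n n ℝ} (hV : ∀ i j, Measurable fun ω => V ω i j)
    (i j : n) : Measurable fun ω => (V ω)⁻¹ i j := by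
  simp_rw [inv_def, Ring.inverse_eq_inv', Matrix.smul_apply, adjugate_apply, smul_eq_mul]
  refine (measurable_det hV).inv.mul (measurable_det fun k l => ?_)
  simp_rw [updateRow_apply]
  split_ifs
  · exact measurable_const
  · exact hV k l

theorem measurable_dotProduct_inv_mulVec {V : Ω → Matrix n n ℝ}
    (hV : ∀ i j, Measurable fun ω => V ω i j) {S S' : Ω → n → ℝ} (hS : Measurable S)
    (hS' : Measurable S') : Measurable fun ω => S ω ⬝ᵥ (V ω)⁻¹ *ᵥ S' ω := by
  simp only [dotProduct, mulVec]
  exact Finset.measurable_fun_sum _ fun i _ => ((measurable_pi_apply i).comp hS).mul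
    (Finset.measurable_fun_sum _ fun j _ =>
      (measurable_inv_apply hV i j).mul ((measurable_pi_apply j).comp hS'))

variable {d K : ℕ} {x : ℕ → Ω → Fin K → EuclideanSpace ℝ (Fin d)}
  {pol : ℕ → Ω → Fin K → ℝ} {A : ℕ → Ω → Fin K} {R : ℕ → Ω → ℝ}
  {θstar : EuclideanSpace ℝ (Fin d)} {t : ℕ}

theorem measurable_context_arm (hx : Measurable (x t)) (hA : Measurable (A t)) :
    Measurable fun ω => x t ω (A t ω) :=
  (measurable_from_prod_countable_left (f := fun p : (Fin K → EuclideanSpace ℝ (Fin d)) × Fin K =>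
    p.1 p.2) fun a => measurable_pi_apply a).comp (hx.prodMk hA)

theorem measurable_ofLp_comp {X : Ω → EuclideanSpace ℝ (Fin d)} (hX : Measurable X) :
    Measurable fun ω => (X ω).ofLp :=
  (WithLp.measurable_ofLp 2 _).comp hX

theorem measurable_noise (hx : Measurable (x t)) (hA : Measurable (A t)) (hR : Measurable (R t)) :
    Measurable (noise θstar x A R t) :=
  hR.sub (measurable_const.inner (measurable_context_arm hx hA))

theorem measurable_designMatrix_apply (lam : ℝ) (hx : ∀ s ∈ Finset.Ico 1 t, Measurable (x s))
    (hA : ∀ s ∈ Finset.Ico 1 t, Measurable (A s)) (i j : Fin d) :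
    Measurable fun ω => designMatrix lam x A t ω i j := by
  simp only [designMatrix, Matrix.add_apply, Matrix.sum_apply, vecMulVec_apply]
  refine measurable_const.add (Finset.measurable_fun_sum _ fun s hs => ?_)
  have h := measurable_ofLp_comp (measurable_context_arm (hx s hs) (hA s hs))
  exact ((measurable_pi_apply i).comp h).mul ((measurable_pi_apply j).comp h)

theorem measurable_noiseSum (hx : ∀ s ∈ Finset.Ico 1 t, Measurable (x s))
    (hA : ∀ s ∈ Finset.Ico 1 t, Measurable (A s)) (hR : ∀ s ∈ Finset.Ico 1 t, Measurable (R s)) :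
    Measurable (noiseSum θstar x A R t) :=
  Finset.measurable_fun_sum _ fun s hs => (measurable_noise (hx s hs) (hA s hs) (hR s hs)).smul
    (measurable_ofLp_comp (measurable_context_arm (hx s hs) (hA s hs)))

theorem measurable_width (hx : ∀ s ∈ Finset.Icc 1 t, Measurable (x s)) (ht : 1 ≤ t)
    (hA : ∀ s ∈ Finset.Ico 1 t, Measurable (A s)) (a : Fin K) :
    Measurable fun ω => width x A t ω a := by
  have hxa := measurable_ofLp_comp
    ((measurable_pi_apply a).comp (hx t (Finset.mem_Icc.2 ⟨ht, le_rfl⟩)))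
  exact (measurable_dotProduct_inv_mulVec (measurable_designMatrix_apply 1
    (fun s hs => hx s (Finset.Ico_subset_Icc_self hs)) hA) hxa hxa).sqrt

theorem measurable_width_arm (hx : ∀ s ∈ Finset.Icc 1 t, Measurable (x s)) (ht : 1 ≤ t)
    (hA : ∀ s ∈ Finset.Icc 1 t, Measurable (A s)) :
    Measurable fun ω => width x A t ω (A t ω) := by
  have htt := Finset.mem_Icc.2 ⟨ht, le_rfl⟩
  have hxa := measurable_ofLp_comp (measurable_context_arm (hx t htt) (hA t htt))
  exact (measurable_dotProduct_inv_mulVec (measurable_designMatrix_apply 1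
    (fun s hs => hx s (Finset.Ico_subset_Icc_self hs))
    (fun s hs => hA s (Finset.Ico_subset_Icc_self hs))) hxa hxa).sqrt

theorem measurable_meanWidth (hx : ∀ s ∈ Finset.Icc 1 t, Measurable (x s)) (ht : 1 ≤ t)
    (hA : ∀ s ∈ Finset.Ico 1 t, Measurable (A s)) (hpol : Measurable (pol t)) :
    Measurable (meanWidth x pol A t) :=
  Finset.measurable_fun_sum _ fun a _ =>
    ((measurable_pi_apply a).comp hpol).mul (measurable_width hx ht hA a)

end Measurability

/-! ### The σ-algebras of the interaction -/

section Information

variable {Ω : Type*} {d K : ℕ} {x : ℕ → Ω → Fin K → EuclideanSpace ℝ (Fin d)}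
  {pol : ℕ → Ω → Fin K → ℝ} {A : ℕ → Ω → Fin K} {R : ℕ → Ω → ℝ} {s t : ℕ}

theorem comap_le_history (hs : s ∈ Finset.Ico 1 t) :
    MeasurableSpace.comap (x s) inferInstance ⊔ MeasurableSpace.comap (pol s) inferInstance ⊔
      MeasurableSpace.comap (A s) inferInstance ⊔ MeasurableSpace.comap (R s) inferInstance
      ≤ history x pol A R t :=
  le_iSup₂_of_le (f := fun s (_ : s ∈ Finset.Ico 1 t) =>
    MeasurableSpace.comap (x s) inferInstance ⊔ MeasurableSpace.comap (pol s) inferInstance ⊔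
      MeasurableSpace.comap (A s) inferInstance ⊔ MeasurableSpace.comap (R s) inferInstance)
    s hs le_rfl

theorem history_le_policyInfo : history x pol A R t ≤ policyInfo x pol A R t :=
  le_sup_left.trans le_sup_left

theorem policyInfo_le_armInfo : policyInfo x pol A R t ≤ armInfo x pol A R t := le_sup_left

theorem measurable_history_context (hs : s ∈ Finset.Ico 1 t) :
    Measurable[history x pol A R t] (x s) :=
  measurable_iff_comap_le.2
    ((le_sup_left.trans (le_sup_left.trans le_sup_left)).trans (comap_le_history hs))

theorem measurable_history_policy (hs : s ∈ Finset.Ico 1 t) :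
    Measurable[history x pol A R t] (pol s) :=
  measurable_iff_comap_le.2
    ((le_sup_right.trans (le_sup_left.trans le_sup_left)).trans (comap_le_history hs))

theorem measurable_history_arm (hs : s ∈ Finset.Ico 1 t) :
    Measurable[history x pol A R t] (A s) :=
  measurable_iff_comap_le.2 ((le_sup_right.trans le_sup_left).trans (comap_le_history hs))

theorem measurable_history_reward (hs : s ∈ Finset.Ico 1 t) :
    Measurable[history x pol A R t] (R s) :=
  measurable_iff_comap_le.2 (le_sup_right.trans (comap_le_history hs))

theorem measurable_policyInfo_context (hs : s ∈ Finset.Icc 1 t) :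
    Measurable[policyInfo x pol A R t] (x s) := by
  rcases (Finset.mem_Icc.1 hs).2.eq_or_lt with rfl | h
  · exact measurable_iff_comap_le.2 (le_sup_right.trans le_sup_left)
  · exact (measurable_history_context (Finset.mem_Ico.2 ⟨(Finset.mem_Icc.1 hs).1, h⟩)).mono
      history_le_policyInfo le_rfl

theorem measurable_policyInfo_policy : Measurable[policyInfo x pol A R t] (pol t) :=
  measurable_iff_comap_le.2 le_sup_right

theorem measurable_armInfo_arm : Measurable[armInfo x pol A R t] (A t) :=
  measurable_iff_comap_le.2 le_sup_right

variable [mΩ : MeasurableSpace Ω] {μ : Measure Ω} {θstar : EuclideanSpace ℝ (Fin d)}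

theorem IsLinearBanditInteraction.policyInfo_le
    (h : IsLinearBanditInteraction μ θstar x pol A R) (ht : 1 ≤ t) :
    policyInfo x pol A R t ≤ mΩ := by
  refine sup_le (sup_le (iSup₂_le fun s hs => ?_) (h.measurable_context t ht).comap_le)
    (h.measurable_policy t ht).comap_le
  have hs1 := (Finset.mem_Ico.1 hs).1
  exact sup_le (sup_le (sup_le (h.measurable_context s hs1).comap_le
    (h.measurable_policy s hs1).comap_le) (h.measurable_arm s hs1).comap_le)
    (h.measurable_reward s hs1).comap_le

theorem IsLinearBanditInteraction.armInfo_le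
    (h : IsLinearBanditInteraction μ θstar x pol A R) (ht : 1 ≤ t) :
    armInfo x pol A R t ≤ mΩ :=
  sup_le (h.policyInfo_le ht) (h.measurable_arm t ht).comap_le

end Information

/-! ### The two exponential supermartingales -/

section Concentration

open Matrix
open scoped ENNReal

variable {Ω : Type*} {mΩ : MeasurableSpace Ω} {μ : Measure Ω} [IsProbabilityMeasure μ] {d K : ℕ}
  {x : ℕ → Ω → Fin K → EuclideanSpace ℝ (Fin d)} {pol : ℕ → Ω → Fin K → ℝ} {A : ℕ → Ω → Fin K}
  {R : ℕ → Ω → ℝ} {θstar : EuclideanSpace ℝ (Fin d)} {t : ℕ}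

/-- The self-normalized exponential supermartingale. -/
noncomputable def selfNormalizedExp (θstar : EuclideanSpace ℝ (Fin d))
    (x : ℕ → Ω → Fin K → EuclideanSpace ℝ (Fin d)) (A : ℕ → Ω → Fin K) (R : ℕ → Ω → ℝ)
    (t : ℕ) (ω : Ω) : ℝ :=
  Real.exp ((noiseSum θstar x A R t ω ⬝ᵥ
    (designMatrix 1 x A t ω)⁻¹ *ᵥ noiseSum θstar x A R t ω) / 2) /
      √(designMatrix 1 x A t ω).det

theorem selfNormalizedExp_nonneg (ω : Ω) : 0 ≤ selfNormalizedExp θstar x A R t ω :=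
  div_nonneg (Real.exp_nonneg _) (Real.sqrt_nonneg _)

/-- The new factor is the integrand of `lintegral_exp_quadratic_le_one`, with `w = xᵀ V⁻¹ S` and `u
= xᵀ V⁻¹ x`, both known before the reward. -/
theorem selfNormalizedExp_succ (ht : 1 ≤ t) (ω : Ω) :
    selfNormalizedExp θstar x A R (t + 1) ω = selfNormalizedExp θstar x A R t ω *
      (Real.exp (-(((x t ω (A t ω)).ofLp ⬝ᵥ
        (designMatrix 1 x A t ω)⁻¹ *ᵥ noiseSum θstar x A R t ω) ^ 2 /
          (2 * (1 + (x t ω (A t ω)).ofLp ⬝ᵥ (designMatrix 1 x A t ω)⁻¹ *ᵥ (x t ω (A t ω)).ofLp)))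
      + ((x t ω (A t ω)).ofLp ⬝ᵥ (designMatrix 1 x A t ω)⁻¹ *ᵥ noiseSum θstar x A R t ω) /
          (1 + (x t ω (A t ω)).ofLp ⬝ᵥ (designMatrix 1 x A t ω)⁻¹ *ᵥ (x t ω (A t ω)).ofLp)
          * noise θstar x A R t ω
      + ((x t ω (A t ω)).ofLp ⬝ᵥ (designMatrix 1 x A t ω)⁻¹ *ᵥ (x t ω (A t ω)).ofLp) /
          (1 + (x t ω (A t ω)).ofLp ⬝ᵥ (designMatrix 1 x A t ω)⁻¹ *ᵥ (x t ω (A t ω)).ofLp)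
          * noise θstar x A R t ω ^ 2 / 2) /
        √(1 + (x t ω (A t ω)).ofLp ⬝ᵥ
          (designMatrix 1 x A t ω)⁻¹ *ᵥ (x t ω (A t ω)).ofLp)) := by
  have hV : (designMatrix 1 x A t ω).PosDef := posDef_designMatrix t
  have hu := dotProduct_inv_mulVec_nonneg hV (x t ω (A t ω)).ofLp
  rw [selfNormalizedExp, selfNormalizedExp, designMatrix_succ 1 ht, noiseSum_succ ht,
    dotProduct_inv_add_vecMulVec_mulVec hV, det_add_vecMulVec_self hV,
    Real.sqrt_mul hV.det_pos.le, div_mul_div_comm, ← Real.exp_add]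
  congr 2
  have : 1 + (x t ω (A t ω)).ofLp ⬝ᵥ (designMatrix 1 x A t ω)⁻¹ *ᵥ (x t ω (A t ω)).ofLp ≠ 0 := by
    positivity
  field_simp
  ring

theorem lintegral_selfNormalizedExp_le_one (h : IsLinearBanditInteraction μ θstar x pol A R)
    (hsub : ∀ t, 1 ≤ t →
      IsCondSubGaussian μ (armInfo x pol A R t) (noise θstar x A R t) 1) (t : ℕ) :
    ∫⁻ ω, ENNReal.ofReal (selfNormalizedExp θstar x A R (t + 1) ω) ∂μ ≤ 1 := by
  induction t with
  | zero => simp [selfNormalizedExp, designMatrix_one_one, noiseSum]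
  | succ t ih =>
    have ht : 1 ≤ t + 1 := by omega
    have hx : ∀ s ∈ Finset.Ico 1 (t + 1), Measurable[armInfo x pol A R (t + 1)] (x s) :=
      fun s hs => (measurable_policyInfo_context (Finset.Ico_subset_Icc_self hs)).mono
        policyInfo_le_armInfo le_rfl
    have hA : ∀ s ∈ Finset.Ico 1 (t + 1), Measurable[armInfo x pol A R (t + 1)] (A s) :=
      fun s hs => (measurable_history_arm hs).mono
        (history_le_policyInfo.trans policyInfo_le_armInfo) le_rfl
    have hR : ∀ s ∈ Finset.Ico 1 (t + 1), Measurable[armInfo x pol A R (t + 1)] (R s) :=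
      fun s hs => (measurable_history_reward hs).mono
        (history_le_policyInfo.trans policyInfo_le_armInfo) le_rfl
    have hxt : Measurable[armInfo x pol A R (t + 1)] (x (t + 1)) :=
      (measurable_policyInfo_context (Finset.mem_Icc.2 ⟨ht, le_rfl⟩)).mono
        policyInfo_le_armInfo le_rfl
    have hV := measurable_designMatrix_apply (m := armInfo x pol A R (t + 1)) 1 hx hA
    have hS := measurable_noiseSum (m := armInfo x pol A R (t + 1)) (θstar := θstar) hx hA hR
    have hxA := measurable_ofLp_comp (m := armInfo x pol A R (t + 1))
      (measurable_context_arm hxt measurable_armInfo_arm)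
    refine le_trans ?_ ih
    simp_rw [selfNormalizedExp_succ ht, ENNReal.ofReal_mul (selfNormalizedExp_nonneg _)]
    refine lintegral_mul_exp_quadratic_le (h.armInfo_le ht)
      (measurable_noise (h.measurable_context _ ht) (h.measurable_arm _ ht)
        (h.measurable_reward _ ht)) (hsub _ ht) ?_
      (measurable_dotProduct_inv_mulVec hV hxA hS) (measurable_dotProduct_inv_mulVec hV hxA hxA)
      fun ω => dotProduct_inv_mulVec_nonneg (posDef_designMatrix _) _
    exact ((Real.measurable_exp.comp
      ((measurable_dotProduct_inv_mulVec hV hS hS).div_const 2)).div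
        (measurable_det hV).sqrt).ennreal_ofReal

/-- In each round the true parameter lies in the confidence region with high probability. -/
theorem measure_notMem_confidenceRegion_le (hd : 0 < d) {δ : ℝ} (hδ : 0 < δ)
    (h : IsLinearBanditInteraction μ θstar x pol A R)
    (hsub : ∀ t, 1 ≤ t →
      IsCondSubGaussian μ (armInfo x pol A R t) (noise θstar x A R t) 1)
    (hx : ∀ t, 1 ≤ t → ∀ ω a, ‖x t ω a‖ ≤ 1) (hθ : ‖θstar‖ ≤ 1) (ht : 1 ≤ t) :
    μ {ω | θstar ∉ confidenceRegion 1 (radius d δ) x A R t ω} ≤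
      ENNReal.ofReal (3 * δ / (Real.pi ^ 2 * t ^ 2)) := by
  have ht' : (0 : ℝ) < t := by exact_mod_cast ht
  have hε : 0 < 3 * δ / (Real.pi ^ 2 * t ^ 2) := by positivity
  have hint : ∫⁻ ω, ENNReal.ofReal (selfNormalizedExp θstar x A R t ω) ∂μ ≤ 1 := by
    obtain ⟨s, rfl⟩ := Nat.exists_eq_add_of_le' ht
    exact lintegral_selfNormalizedExp_le_one h hsub s
  have hV := measurable_designMatrix_apply (x := x) (A := A) (t := t) 1
    (fun s hs => h.measurable_context s (Finset.mem_Ico.1 hs).1)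
    (fun s hs => h.measurable_arm s (Finset.mem_Ico.1 hs).1)
  have hS := measurable_noiseSum (x := x) (A := A) (R := R) (t := t) (θstar := θstar)
    (fun s hs => h.measurable_context s (Finset.mem_Ico.1 hs).1)
    (fun s hs => h.measurable_arm s (Finset.mem_Ico.1 hs).1)
    (fun s hs => h.measurable_reward s (Finset.mem_Ico.1 hs).1)
  have hmeas : Measurable fun ω => ENNReal.ofReal (selfNormalizedExp θstar x A R t ω) :=
    ((Real.measurable_exp.comp ((measurable_dotProduct_inv_mulVec hV hS hS).div_const 2)).div
        (measurable_det hV).sqrt).ennreal_ofReal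
  refine (measure_mono fun ω hω => ?_).trans (measure_inv_le_le_ofReal hε hmeas.aemeasurable hint)
  rw [Set.mem_ofPred_eq, confidenceRegion, Set.mem_ofPred_eq, not_le, radius,
    Real.sqrt_sq (by positivity)] at hω
  have hlt := hω.trans_le (matrixNorm_sub_ridgeEstimate_le hθ t)
  have hlt2 := lt_of_add_lt_add_left hlt
  have hS0 := dotProduct_inv_mulVec_nonneg (posDef_designMatrix (x := x) (A := A) (ω := ω) t)
    (noiseSum θstar x A R t ω)
  -- Only the noise term must be positive, and this follows from the strict inequality of roots; the
  -- sign of the radicand in `radius` is irrelevant.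
  rw [Real.sqrt_lt_sqrt_iff_of_pos (by
    by_contra hcon
    push Not at hcon
    rw [Real.sqrt_eq_zero_of_nonpos hcon] at hlt2
    exact absurd hlt2 (not_lt.2 (Real.sqrt_nonneg _)))] at hlt2
  have hdet : (designMatrix 1 x A t ω).det ≤ (1 + t / d : ℝ) ^ d := by
    obtain ⟨s, rfl⟩ := Nat.exists_eq_add_of_le' ht
    refine (det_designMatrix_succ_le hd (fun t ht => hx t ht ω) s).trans ?_
    gcongr
    linarith
  have hdet0 := (posDef_designMatrix (x := x) (A := A) (ω := ω) t).det_pos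
  have hlog : Real.log (designMatrix 1 x A t ω).det ≤ d * Real.log (1 + t / d) := by
    rw [← Real.log_pow]
    exact Real.log_le_log hdet0 hdet
  rw [Set.mem_ofPred_eq, selfNormalizedExp, le_div_iff₀ (Real.sqrt_pos.2 hdet0), inv_div]
  rw [← Real.log_le_log_iff (by positivity) (Real.exp_pos _), Real.log_exp,
    Real.log_mul (by positivity) (by positivity), Real.log_sqrt hdet0.le]
  linarith

/-- The exponential supermartingale comparing mean and realized widths. -/
noncomputable def widthExp (x : ℕ → Ω → Fin K → EuclideanSpace ℝ (Fin d))
    (pol : ℕ → Ω → Fin K → ℝ) (A : ℕ → Ω → Fin K) (T : ℕ) (ω : Ω) : ℝ :=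
  Real.exp (∑ t ∈ Finset.Icc 1 T, (meanWidth x pol A t ω / 2 - width x A t ω (A t ω)))

/-- On `[0, 1]` one has `exp (-y) ≤ 1 - y / 2`. Averaging gives `1 - m / 2 ≤ exp (-(m / 2))` with
`m` the mean, which explains the factor one half in `widthExp`. -/
theorem sum_mul_exp_half_mean_sub_le_one {ι : Type*} [Fintype ι] {p g : ι → ℝ}
    (hp : ∀ a, 0 ≤ p a) (hp1 : ∑ a, p a = 1) (hg0 : ∀ a, 0 ≤ g a) (hg1 : ∀ a, g a ≤ 1) :
    ∑ a, Real.exp ((∑ b, p b * g b) / 2 - g a) * p a ≤ 1 := by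
  have hexp {y : ℝ} (h0 : 0 ≤ y) (h1 : y ≤ 1) : Real.exp (-y) ≤ 1 - y / 2 := by
    rw [Real.exp_neg, inv_le_iff_one_le_mul₀ (Real.exp_pos _)]
    nlinarith [Real.add_one_le_exp y]
  calc _ = Real.exp ((∑ b, p b * g b) / 2) * ∑ a, Real.exp (-g a) * p a := by
        rw [Finset.mul_sum]
        refine Finset.sum_congr rfl fun a _ => ?_
        rw [sub_eq_add_neg, Real.exp_add, mul_assoc]
    _ ≤ Real.exp ((∑ b, p b * g b) / 2) * ∑ a, (1 - g a / 2) * p a := by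
        gcongr with a
        · exact hp a
        · exact hexp (hg0 a) (hg1 a)
    _ = Real.exp ((∑ b, p b * g b) / 2) * (-((∑ b, p b * g b) / 2) + 1) := by
        congr 1
        have hterm (a : ι) : (1 - g a / 2) * p a = p a - p a * g a / 2 := by ring
        simp_rw [hterm]
        rw [Finset.sum_sub_distrib, hp1, ← Finset.sum_div, neg_add_eq_sub]
    _ ≤ Real.exp ((∑ b, p b * g b) / 2) * Real.exp (-((∑ b, p b * g b) / 2)) := by
        gcongr
        exact Real.add_one_le_exp _
    _ = 1 := by rw [← Real.exp_add, add_neg_cancel, Real.exp_zero]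

theorem lintegral_widthExp_le_one (h : IsLinearBanditInteraction μ θstar x pol A R)
    (hx : ∀ t, 1 ≤ t → ∀ ω a, ‖x t ω a‖ ≤ 1) (hpol0 : ∀ t, 1 ≤ t → ∀ ω a, 0 ≤ pol t ω a)
    (hpol1 : ∀ t, 1 ≤ t → ∀ ω, ∑ a, pol t ω a = 1) (T : ℕ) :
    ∫⁻ ω, ENNReal.ofReal (widthExp x pol A T ω) ∂μ ≤ 1 := by
  induction T with
  | zero => simp [widthExp]
  | succ T ih =>
    have hT : 1 ≤ T + 1 := by omega
    have hxm : ∀ s ∈ Finset.Icc 1 (T + 1), Measurable[policyInfo x pol A R (T + 1)] (x s) :=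
      fun s hs => measurable_policyInfo_context hs
    have hAm : ∀ s ∈ Finset.Ico 1 (T + 1), Measurable[policyInfo x pol A R (T + 1)] (A s) :=
      fun s hs => (measurable_history_arm hs).mono history_le_policyInfo le_rfl
    have hpm : ∀ s ∈ Finset.Ico 1 (T + 1), Measurable[policyInfo x pol A R (T + 1)] (pol s) :=
      fun s hs => (measurable_history_policy hs).mono history_le_policyInfo le_rfl
    have hW : Measurable[policyInfo x pol A R (T + 1)]
        fun ω => ENNReal.ofReal (widthExp x pol A T ω) := by
      refine (Real.measurable_exp.comp (Finset.measurable_fun_sum _ fun t ht => ?_)).ennreal_ofReal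
      obtain ⟨ht1, ht2⟩ := Finset.mem_Icc.1 ht
      have hx' : ∀ s ∈ Finset.Icc 1 t, Measurable[policyInfo x pol A R (T + 1)] (x s) :=
        fun s hs => hxm s (by simp only [Finset.mem_Icc] at hs ⊢; omega)
      have hA' : ∀ s ∈ Finset.Icc 1 t, Measurable[policyInfo x pol A R (T + 1)] (A s) :=
        fun s hs => hAm s (by simp only [Finset.mem_Icc, Finset.mem_Ico] at hs ⊢; omega)
      exact ((measurable_meanWidth hx' ht1 (fun s hs => hA' s (Finset.Ico_subset_Icc_self hs))
        (hpm t (by simp only [Finset.mem_Ico]; omega))).div_const 2).sub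
          (measurable_width_arm hx' ht1 hA')
    have hg : Measurable[policyInfo x pol A R (T + 1)] (meanWidth x pol A (T + 1)) :=
      measurable_meanWidth (m := policyInfo x pol A R (T + 1)) hxm hT hAm
        measurable_policyInfo_policy
    have hstep := lintegral_comp_eq_of_condExp_indicator (μ := μ) (h.policyInfo_le hT) (h.measurable_arm _ hT)
      measurable_policyInfo_policy (hpol0 _ hT) (h.arm_law _ hT)
      (H := fun b ω => ENNReal.ofReal (widthExp x pol A T ω) * ENNReal.ofReal
        (Real.exp (meanWidth x pol A (T + 1) ω / 2 - width x A (T + 1) ω b)))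
      fun b => hW.mul (Real.measurable_exp.comp ((hg.div_const 2).sub
        (measurable_width (m := policyInfo x pol A R (T + 1)) hxm hT hAm b))).ennreal_ofReal
    calc _ = _ := by
          refine lintegral_congr fun ω => ?_
          rw [widthExp, Finset.sum_Icc_succ_top hT, Real.exp_add,
            ENNReal.ofReal_mul (Real.exp_nonneg _)]
          rfl
      _ = _ := hstep
      -- The sampled arm has been averaged out, so the new factor is at most one pointwise.
      _ ≤ ∫⁻ ω, ENNReal.ofReal (widthExp x pol A T ω) ∂μ := by
          refine lintegral_mono fun ω => ?_
          simp_rw [mul_assoc, ← ENNReal.ofReal_mul (Real.exp_nonneg _)]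
          rw [← Finset.mul_sum, ← ENNReal.ofReal_sum_of_nonneg fun b _ =>
            mul_nonneg (Real.exp_nonneg _) (hpol0 _ hT ω b)]
          refine mul_le_of_le_one_right' (ENNReal.ofReal_le_one.2 ?_)
          exact sum_mul_exp_half_mean_sub_le_one (hpol0 _ hT ω) (hpol1 _ hT ω)
            (fun a => width_nonneg _ _) (fun a => width_le_one (hx _ hT ω a))
      _ ≤ 1 := ih

/-- The mean widths are controlled by the realized ones with high probability. -/
theorem measure_sum_meanWidth_gt_le (h : IsLinearBanditInteraction μ θstar x pol A R)
    (hx : ∀ t, 1 ≤ t → ∀ ω a, ‖x t ω a‖ ≤ 1) (hpol0 : ∀ t, 1 ≤ t → ∀ ω a, 0 ≤ pol t ω a)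
    (hpol1 : ∀ t, 1 ≤ t → ∀ ω, ∑ a, pol t ω a = 1) {ε : ℝ} (hε : 0 < ε) (T : ℕ) :
    μ {ω | 2 * ∑ t ∈ Finset.Icc 1 T, width x A t ω (A t ω) + 2 * Real.log ε⁻¹ <
      ∑ t ∈ Finset.Icc 1 T, meanWidth x pol A t ω} ≤ ENNReal.ofReal ε := by
  have hmeas : Measurable fun ω => ENNReal.ofReal (widthExp x pol A T ω) := by
    refine (Real.measurable_exp.comp (Finset.measurable_fun_sum _ fun t ht => ?_)).ennreal_ofReal
    have ht1 := (Finset.mem_Icc.1 ht).1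
    have hx' : ∀ s ∈ Finset.Icc 1 t, Measurable (x s) :=
      fun s hs => h.measurable_context s (Finset.mem_Icc.1 hs).1
    have hA' : ∀ s ∈ Finset.Icc 1 t, Measurable (A s) :=
      fun s hs => h.measurable_arm s (Finset.mem_Icc.1 hs).1
    exact ((measurable_meanWidth hx' ht1 (fun s hs => hA' s (Finset.Ico_subset_Icc_self hs))
      (h.measurable_policy t ht1)).div_const 2).sub (measurable_width_arm hx' ht1 hA')
  refine (measure_mono fun ω hω => ?_).trans (measure_inv_le_le_ofReal hε hmeas.aemeasurable
    (lintegral_widthExp_le_one h hx hpol0 hpol1 T))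
  rw [Set.mem_ofPred_eq] at hω ⊢
  rw [widthExp, ← Real.log_le_iff_le_exp (by positivity), Finset.sum_sub_distrib,
    ← Finset.sum_div]
  linarith

end Concentration

/-! ### Constants and the deterministic bound -/

section RegretBound

variable {d T t : ℕ} {δ : ℝ}

theorem log_two_mul_div_le (hδ : 0 < δ) (hT : 0 < T) :
    Real.log (2 * (T / δ)) ≤ 1 + Real.log (T / δ) := by
  have : (0 : ℝ) < T := by exact_mod_cast hT
  rw [Real.log_mul (by norm_num) (by positivity)]
  linarith [Real.log_two_lt_d9]

theorem one_le_div (hδ : 0 < δ) (hδ1 : δ < 1) (hT : 0 < T) : (1 : ℝ) ≤ T / δ := by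
  have : (1 : ℝ) ≤ T := by exact_mod_cast hT
  rw [le_div_iff₀ hδ]
  linarith

theorem log_one_add_div_le (hd : 0 < d) (hδ : 0 < δ) (hδ1 : δ < 1) (ht : t ≤ T) (hT : 0 < T) :
    Real.log (1 + t / d) ≤ 1 + Real.log (T / δ) := by
  refine le_trans (Real.log_le_log (by positivity) ?_) (log_two_mul_div_le hδ hT)
  have hd' : (1 : ℝ) ≤ d := by exact_mod_cast hd
  have htT : (t : ℝ) ≤ T := by exact_mod_cast ht
  have h1 : (t : ℝ) / d ≤ t := div_le_self (by positivity) hd'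
  have h2 : (T : ℝ) ≤ T / δ := le_div_self (by positivity) hδ hδ1.le
  linarith [one_le_div hδ hδ1 hT]

theorem sqrt_radius_le (hd : 0 < d) (hδ : 0 < δ) (hδ1 : δ < 1) (ht : 1 ≤ t) (htT : t ≤ T) :
    √(radius d δ t) ≤ 4 * √(d * (1 + Real.log (T / δ))) := by
  have hT : 0 < T := by omega
  have ht' : (0 : ℝ) < t := by exact_mod_cast ht
  have hT' : (0 : ℝ) < T := by exact_mod_cast hT
  have htT' : (t : ℝ) ≤ T := by exact_mod_cast htT
  have hd' : (1 : ℝ) ≤ d := by exact_mod_cast hd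
  set L := 1 + Real.log (T / δ) with hL
  have hL1 : 1 ≤ L := by
    have := Real.log_nonneg (one_le_div hδ hδ1 hT)
    linarith
  have hlog : Real.log (Real.pi ^ 2 * t ^ 2 / (3 * δ)) ≤ 2 * L := by
    calc _ ≤ Real.log ((2 * (T / δ)) ^ 2) := by
          refine Real.log_le_log (by positivity) ?_
          -- The value `12 = 3 * 4` makes the argument of the logarithm at most `(2 * (T / δ)) ^ 2`.
          have hpi : Real.pi ^ 2 ≤ 12 := by nlinarith [Real.pi_lt_d2, Real.pi_pos]
          rw [mul_pow, div_pow, div_le_iff₀ (by positivity)]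
          calc Real.pi ^ 2 * (t : ℝ) ^ 2 ≤ 12 * (T : ℝ) ^ 2 := by gcongr
            _ ≤ 12 * (T : ℝ) ^ 2 / δ := le_div_self (by positivity) hδ hδ1.le
            _ = _ := by field_simp; ring
      _ = 2 * Real.log (2 * (T / δ)) := by rw [Real.log_pow]; norm_num
      _ ≤ 2 * L := by
          have := log_two_mul_div_le hδ hT
          linarith
  have hdL : 1 ≤ d * L := one_le_mul_of_one_le_of_one_le hd' hL1
  rw [radius, Real.sqrt_sq (by positivity)]
  have h1 : 1 ≤ √(d * L) := Real.one_le_sqrt.2 hdL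
  have h2 : √(d * Real.log (1 + t / d) + 2 * Real.log (Real.pi ^ 2 * t ^ 2 / (3 * δ)))
      ≤ 3 * √(d * L) := by
    rw [show (3 : ℝ) = √(3 ^ 2) by rw [Real.sqrt_sq (by norm_num)],
      ← Real.sqrt_mul (by positivity)]
    refine Real.sqrt_le_sqrt ?_
    have h3 : d * Real.log (1 + t / d) ≤ d * L := by
      gcongr
      exact log_one_add_div_le hd hδ hδ1 htT hT
    have h4 : L ≤ d * L := le_mul_of_one_le_left (by linarith) hd'
    linarith
  linarith

/-- The Basel sum `π² / 6` shows that the radii spend only half of the confidence budget. -/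
theorem sum_inv_sq_mul_le (T : ℕ) (hδ : 0 < δ) :
    ∑ t ∈ Finset.Icc 1 T, 3 * δ / (Real.pi ^ 2 * (t : ℝ) ^ 2) ≤ δ / 2 := by
  have h := sum_le_hasSum (Finset.Icc 1 T) (fun t _ => by positivity) hasSum_zeta_two
  calc _ = 3 * δ / Real.pi ^ 2 * ∑ t ∈ Finset.Icc 1 T, 1 / (t : ℝ) ^ 2 := by
        rw [Finset.mul_sum]
        refine Finset.sum_congr rfl fun t _ => ?_
        rw [div_mul_div_comm, mul_one]
    _ ≤ 3 * δ / Real.pi ^ 2 * (Real.pi ^ 2 / 6) := by gcongr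
    _ = δ / 2 := by
        field_simp
        norm_num

/-- On the intersection of the concentration events the regret bound is deterministic. -/
theorem rewardRegret_le {Ω : Type*} {K : ℕ} {x : ℕ → Ω → Fin K → EuclideanSpace ℝ (Fin d)}
    {pol : ℕ → Ω → Fin K → ℝ} {A : ℕ → Ω → Fin K} {R : ℕ → Ω → ℝ}
    {θstar : EuclideanSpace ℝ (Fin d)} {f : ℝ → ℝ} {ω : Ω} (hd : 0 < d) (hδ : 0 < δ) (hδ1 : δ < 1)
    (hT : 0 < T) (hf : ∀ z, 0 < f z) (h : IsFairXLinUCB f 1 (radius d δ) x pol A R)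
    (hx : ∀ t, 1 ≤ t → ∀ a, ‖x t ω a‖ ≤ 1) (hpol0 : ∀ t, 1 ≤ t → ∀ a, 0 ≤ pol t ω a)
    (hmem : ∀ t ∈ Finset.Icc 1 T, θstar ∈ confidenceRegion 1 (radius d δ) x A R t ω)
    (hwidth : ∑ t ∈ Finset.Icc 1 T, meanWidth x pol A t ω ≤
      2 * ∑ t ∈ Finset.Icc 1 T, width x A t ω (A t ω) + 2 * Real.log (δ / 2)⁻¹) :
    rewardRegret f θstar x pol T ω ≤ 40 * d * √T * (1 + Real.log (T / δ)) ^ 2 := by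
  have hd' : (1 : ℝ) ≤ d := by exact_mod_cast hd
  have hT' : (1 : ℝ) ≤ T := by exact_mod_cast hT
  set L := 1 + Real.log (T / δ) with hL
  have hL1 : 1 ≤ L := by
    have := Real.log_nonneg (one_le_div hδ hδ1 hT)
    linarith
  have hdL : 1 ≤ d * L := one_le_mul_of_one_le_of_one_le hd' hL1
  -- Both the radius and the total width are of order `q`; the product `q * q = d * L` yields the
  -- linear dependence on `d`.
  set q := √(d * L) with hq
  have hq0 : 0 ≤ q := Real.sqrt_nonneg _
  have hqq : q * q = d * L := Real.mul_self_sqrt (by positivity)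
  have hq1 : 1 ≤ q := Real.one_le_sqrt.2 hdL
  have hsT : 1 ≤ √(T : ℝ) := Real.one_le_sqrt.2 hT'
  have hwsum : ∑ t ∈ Finset.Icc 1 T, width x A t ω (A t ω) ≤ 3 / 2 * (√T * q) := by
    have hcs := sq_sum_le_card_mul_sum_sq (s := Finset.Icc 1 T)
      (f := fun t => width x A t ω (A t ω))
    have hpot := sum_width_sq_le (A := A) hd hx T
    have hlog : d * Real.log (1 + T / d) ≤ d * L := by
      gcongr
      exact log_one_add_div_le hd hδ hδ1 le_rfl hT
    refine abs_le_of_sq_le_sq' ?_ (by positivity) |>.2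
    rw [Nat.card_Icc, Nat.add_sub_cancel] at hcs
    calc _ ≤ (T : ℝ) * (2 * (d * L)) := by
          refine hcs.trans ?_
          gcongr
          linarith
      _ ≤ 9 / 4 * (T * (d * L)) := by
          have : 0 ≤ (T : ℝ) * (d * L) := by positivity
          linarith
      _ = _ := by
          rw [mul_pow, mul_pow, Real.sq_sqrt (by positivity), sq q, hqq]
          norm_num
  have hlogδ : Real.log (δ / 2)⁻¹ ≤ L := by
    refine le_trans (Real.log_le_log (by positivity) ?_) (log_two_mul_div_le hδ hT)
    rw [inv_div, ← mul_div_assoc]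
    gcongr
    linarith
  have hmean0 (t : ℕ) (ht : t ∈ Finset.Icc 1 T) : 0 ≤ meanWidth x pol A t ω :=
    Finset.sum_nonneg fun a _ => mul_nonneg (hpol0 t (Finset.mem_Icc.1 ht).1 a) (width_nonneg _ _)
  calc rewardRegret f θstar x pol T ω
      ≤ ∑ t ∈ Finset.Icc 1 T, 8 * q * meanWidth x pol A t ω := by
        rw [rewardRegret, ← Finset.sum_sub_distrib]
        refine Finset.sum_le_sum fun t ht => ?_
        obtain ⟨ht1, htT⟩ := Finset.mem_Icc.1 ht
        refine (expectedReward_sub_le hf h ht1 (hmem t ht)).trans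
          (mul_le_mul_of_nonneg_right ?_ (hmean0 t ht))
        have := sqrt_radius_le hd hδ hδ1 ht1 htT
        linarith
    _ ≤ 8 * q * (3 * (√T * q) + 2 * L) := by
        rw [← Finset.mul_sum]
        gcongr
        linarith
    _ = 24 * (√T * (d * L)) + 16 * (q * L) := by rw [← hqq]; ring
    _ ≤ 24 * (√T * (d * L) * L) + 16 * (√T * (d * L) * L) := by
        have h1 : √T * (d * L) ≤ √T * (d * L) * L := le_mul_of_one_le_right (by positivity) hL1
        have h2 : q * L ≤ √T * (d * L) * L := by
          gcongr
          calc q ≤ q * q := le_mul_of_one_le_left hq0 hq1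
            _ = d * L := hqq
            _ ≤ √T * (d * L) := le_mul_of_one_le_left (by positivity) hsT
        linarith
    _ = 40 * d * √T * L ^ 2 := by ring

end RegretBound

end FairX

/-! ### Union bound over the failure events -/

theorem theorem9 :
    ∃ C : ℝ, ∃ k : ℕ, 0 < C ∧
      ∀ (d K : ℕ) (f : ℝ → ℝ), (∀ z, 0 < f z) →
      ∀ δ : ℝ, 0 < δ → δ < 1 →
      ∀ (Ω : Type*) [MeasurableSpace Ω] (μ : Measure Ω) [IsProbabilityMeasure μ]
        (θstar : EuclideanSpace ℝ (Fin d))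
        (x : ℕ → Ω → Fin K → EuclideanSpace ℝ (Fin d)) (pol : ℕ → Ω → Fin K → ℝ)
        (A : ℕ → Ω → Fin K) (R : ℕ → Ω → ℝ),
        FairX.IsLinearBanditInteraction μ θstar x pol A R →
        FairX.IsFairXLinUCB f 1 (FairX.radius d δ) x pol A R →
        (∀ t, 1 ≤ t → ∀ ω a, ‖x t ω a‖ ≤ 1) →
        (∀ t, 1 ≤ t → FairX.IsCondSubGaussian μ (FairX.armInfo x pol A R t)
          (FairX.noise θstar x A R t) 1) →
        ‖θstar‖ ≤ 1 →
        ∀ T : ℕ, 0 < T →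
          μ {ω | C * d * Real.sqrt T * (1 + Real.log (T / δ)) ^ k <
            FairX.rewardRegret f θstar x pol T ω} ≤ ENNReal.ofReal δ := by
  refine ⟨40, 2, by norm_num, ?_⟩
  intro d K f hf δ hδ hδ1 Ω _ μ _ θstar x pol A R h hucb hx hsub hθ T hT
  -- In dimension zero all rewards vanish; the determinant bounds divide by `d`.
  rcases Nat.eq_zero_or_pos d with rfl | hd
  · have hinner (v w : EuclideanSpace ℝ (Fin 0)) : inner ℝ v w = (0 : ℝ) := by
      rw [Subsingleton.elim v 0, inner_zero_left]
    simp [FairX.rewardRegret, FairX.expectedReward, hinner]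
  have hpol0 (t : ℕ) (ht : 1 ≤ t) (ω : Ω) (a : Fin K) : 0 ≤ pol t ω a := by
    obtain ⟨θ, -, -, hpol⟩ := hucb t ht ω
    rw [hpol]
    exact div_nonneg (hf _).le (Finset.sum_nonneg fun b _ => (hf _).le)
  have hpol1 (t : ℕ) (ht : 1 ≤ t) (ω : Ω) : ∑ a, pol t ω a = 1 := by
    obtain ⟨θ, -, -, hpol⟩ := hucb t ht ω
    -- The sampled arm itself witnesses that there are arms, so `K = 0` needs no separate case.
    have : Nonempty (Fin K) := ⟨A t ω⟩
    simp only [hpol, FairX.fairPolicy]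
    rw [← Finset.sum_div]
    exact div_self (Finset.sum_pos (fun b _ => hf _) Finset.univ_nonempty).ne'
  have hsubset : {ω | 40 * d * Real.sqrt T * (1 + Real.log (T / δ)) ^ 2 <
      FairX.rewardRegret f θstar x pol T ω} ⊆
      (⋃ t ∈ Finset.Icc 1 T,
        {ω | θstar ∉ FairX.confidenceRegion 1 (FairX.radius d δ) x A R t ω}) ∪
      {ω | 2 * ∑ t ∈ Finset.Icc 1 T, FairX.width x A t ω (A t ω) + 2 * Real.log (δ / 2)⁻¹ <
        ∑ t ∈ Finset.Icc 1 T, FairX.meanWidth x pol A t ω} := by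
    intro ω hω
    by_contra hcon
    simp only [Set.mem_union, Set.mem_iUnion, Set.mem_ofPred_eq, not_or, not_exists, not_not,
      not_lt] at hcon
    exact absurd (FairX.rewardRegret_le hd hδ hδ1 hT hf hucb (fun t ht => hx t ht ω)
      (fun t ht => hpol0 t ht ω) hcon.1 hcon.2) (not_le.2 hω)
  calc _ ≤ _ := measure_mono hsubset
    _ ≤ _ := measure_union_le _ _
    _ ≤ ENNReal.ofReal (δ / 2) + ENNReal.ofReal (δ / 2) := by
        refine add_le_add ?_
          (FairX.measure_sum_meanWidth_gt_le h hx hpol0 hpol1 (by positivity) T)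
        calc _ ≤ ∑ t ∈ Finset.Icc 1 T, μ
              {ω | θstar ∉ FairX.confidenceRegion 1 (FairX.radius d δ) x A R t ω} :=
              measure_biUnion_finset_le _ _
          _ ≤ ∑ t ∈ Finset.Icc 1 T, ENNReal.ofReal (3 * δ / (Real.pi ^ 2 * (t : ℝ) ^ 2)) :=
              Finset.sum_le_sum fun t ht => FairX.measure_notMem_confidenceRegion_le hd hδ h hsub
                hx hθ (Finset.mem_Icc.1 ht).1
          _ = ENNReal.ofReal (∑ t ∈ Finset.Icc 1 T, 3 * δ / (Real.pi ^ 2 * (t : ℝ) ^ 2)) :=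
              (ENNReal.ofReal_sum_of_nonneg fun t _ => by positivity).symm
          _ ≤ ENNReal.ofReal (δ / 2) := ENNReal.ofReal_le_ofReal (FairX.sum_inv_sq_mul_le T hδ)
    _ = ENNReal.ofReal δ := by
        rw [← ENNReal.ofReal_add (by positivity) (by positivity), add_halves]
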